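/- Let $M=(M_k)_{k\in\mathbb N}$ be a sequence of positive reals with $M_0=1\le M_1$ that is log-convex, i.e. $M_k^2\le M_{k-1}M_{k+1}$ for all $k\ge 1$. **Definitions.** (a) For $U$ open in a normed space $G$ and a normed space $H$, $C^{(M)}(U,H)$ (resp. $C^{\{M\}}(U,H)$) is the set of infinitely often Fréchet differentiable maps $f:U\to H$ such that for every compact $K\subseteq U$ and every $\rho>0$ (resp. some $\rho>0$) $$\sup\Big\{\frac{\|f^{(k)}(x)\|_{L^k(G,H)}}{k!\,\rho^k\,M_k}:x\in K,\ k\in\mathbb N\Big\}<\infty .$$ (b) For a closed absolutely convex bounded non-empty subset $B$ of a Hausdorff real locally convex space $E$ let $E_B$ be the linear span of $B$, normed by the Minkowski functional of $B$, and let $i_B:E_B\to E$ be the inclusion. $E$ is a convenient vector space if every $E_B$ is complete. A set $U\subseteq E$ is $c^\infty$-open if $c^{-1}(U)$ is open in $\mathbb R$ for every smooth curve $c:\mathbb R\to E$ (a curve all of whose iterated derivatives, as limits of difference quotients, exist). A map defined on a $c^\infty$-open $U$ is $C^\infty$ if it maps smooth curves in $U$ to smooth curves. (c) For convenient vector spaces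 $E,F$ and $c^\infty$-open $U\subseteq E$, $C^{(M)}(U,F)$ (resp. $C^{\{M\}}(U,F)$) is the set of $C^\infty$ maps $f:U\to F$ such that for every continuous linear functional $\ell$ on $F$ and every closed absolutely convex bounded $B\subseteq E$ the map $\ell\circ f\circ i_B:i_B^{-1}(U)\to\mathbb R$ is of class $C^{(M)}$ (resp. $C^{\{M\}}$) in the sense of (a). Below, $[M]$ stands for $(M)$ throughout, or for $\{M\}$ throughout. A $C^{[M]}$ (Banach) plot in $E$ is a map $c:D\to E$ of class $C^{[M]}$ in the sense of (c), where $D$ is the open unit ball of a Banach space $G$. **Theorem.** Let $U$ be a $c^\infty$-open subset of a convenient vector space $E$, let $F$ be a Banach space and let $f\in C^{[M]}(U,F)$ in the sense of (c). Then for every $C^{[M]}$-plot $c:D\to E$ with $c(D)\subseteq U$ the composite $f\circ c:D\to F$ is of class $C^{[M]}$, both in the sense of (c) and in the sense of (a). -/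

import Mathlib

open Set Filter Topology
open scoped ContDiff

noncomputable section

namespace DenjoyCarleman

/-- A (nonempty) closed absolutely convex bounded subset `B` of a topological vector space `E`. -/
structure Disk (E : Type*) [AddCommGroup E] [Module ℝ E] [TopologicalSpace E] where
  carrier : Set E
  nonempty : carrier.Nonempty
  isClosed : IsClosed carrier
  absConvex : AbsConvex ℝ carrier
  bounded : Bornology.IsVonNBounded ℝ carrier

namespace Disk

section Algebra

open scoped Pointwise

variable {E : Type*} [AddCommGroup E] [Module ℝ E] [TopologicalSpace E]

/-- The space `E_B`: the linear span of `B`. It is a type synonym of the subspace, because it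
carries the norm topology defined by `B` instead of the trace of the topology of `E`. -/
def Space (B : Disk E) : Type _ := ↥(Submodule.span ℝ B.carrier)

/-- The set `B`, as a subset of its linear span. -/
def unitSet (B : Disk E) : Set ↥(Submodule.span ℝ B.carrier) := Subtype.val ⁻¹' B.carrier

theorem zero_mem (B : Disk E) : (0 : E) ∈ B.carrier := B.absConvex.1.zero_mem B.nonempty

theorem balanced_unitSet (B : Disk E) : Balanced ℝ B.unitSet := by
  rintro a ha _ ⟨x, hx, rfl⟩
  exact B.absConvex.1 a ha ⟨x.1, hx, rfl⟩

theorem convex_unitSet (B : Disk E) : Convex ℝ B.unitSet :=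
  B.absConvex.2.linear_preimage (Submodule.span ℝ B.carrier).subtype

theorem exists_mem_smul (B : Disk E) {x : E} (hx : x ∈ Submodule.span ℝ B.carrier) :
    ∃ r : ℝ, 0 < r ∧ x ∈ r • B.carrier := by
  induction hx using Submodule.span_induction with
  | mem x hx => exact ⟨1, one_pos, by simpa using hx⟩
  | zero => exact ⟨1, one_pos, by simpa using B.zero_mem⟩
  | add x y _ _ hx hy =>
    obtain ⟨r, hr, hx⟩ := hx
    obtain ⟨s, hs, hy⟩ := hy
    refine ⟨r + s, add_pos hr hs, ?_⟩
    rw [B.absConvex.2.add_smul hr.le hs.le]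
    exact Set.add_mem_add hx hy
  | smul a x _ hx =>
    obtain ⟨r, hr, y, hy, rfl⟩ := hx
    refine ⟨(|a| + 1) * r, by positivity, ?_⟩
    refine B.absConvex.1.smul_mono (a := a * r) ?_ ?_
    · rw [norm_mul, norm_mul, Real.norm_eq_abs, Real.norm_eq_abs (|a| + 1),
        abs_of_pos (by positivity : 0 < |a| + 1)]
      gcongr
      linarith
    · exact ⟨y, hy, by simp [mul_smul]⟩

theorem absorbent_unitSet (B : Disk E) : Absorbent ℝ B.unitSet := by
  rintro ⟨x, hx⟩
  obtain ⟨r, hr, y, hy, hyx⟩ := B.exists_mem_smul hx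
  have hys : y ∈ Submodule.span ℝ B.carrier := Submodule.subset_span hy
  refine Absorbs.of_norm ⟨r, fun c hc => ?_⟩
  rw [Set.singleton_subset_iff]
  refine B.balanced_unitSet.smul_mono (a := r) (by simpa [abs_of_pos hr] using hc) ?_
  exact ⟨⟨y, hys⟩, hy, Subtype.ext hyx⟩

theorem bounded_unitSet (B : Disk E) : Bornology.IsVonNBounded ℝ B.unitSet := by
  intro V hV
  obtain ⟨W, hW, hWV⟩ := (mem_nhds_subtype _ _ _).1 hV
  rw [absorbs_iff_eventually_cobounded_mapsTo]
  filter_upwards [absorbs_iff_eventually_cobounded_mapsTo.1 (B.bounded hW)] with c hc x hx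
  exact hWV (hc hx)

instance (B : Disk E) : AddCommGroup B.Space :=
  inferInstanceAs (AddCommGroup ↥(Submodule.span ℝ B.carrier))

instance (B : Disk E) : Module ℝ B.Space :=
  inferInstanceAs (Module ℝ ↥(Submodule.span ℝ B.carrier))

/-- The norm of `E_B` is the Minkowski functional `‖x‖_B = inf {r > 0 | x ∈ r • B}`. -/
instance (B : Disk E) : Norm B.Space := ⟨fun x => gauge B.unitSet x⟩

/-- The inclusion `i_B : E_B → E`. -/
def incl (B : Disk E) : B.Space →ₗ[ℝ] E := (Submodule.span ℝ B.carrier).subtype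

end Algebra

section Norm

variable {E : Type*} [AddCommGroup E] [Module ℝ E] [TopologicalSpace E]
  [IsTopologicalAddGroup E] [ContinuousSMul ℝ E] [T2Space E]

theorem normedSpaceCore (B : Disk E) : NormedSpace.Core ℝ B.Space where
  norm_nonneg _ := gauge_nonneg _
  norm_smul c x := gauge_smul B.balanced_unitSet c x
  norm_triangle x y := gauge_add_le B.convex_unitSet B.absorbent_unitSet x y
  norm_eq_zero_iff _ := gauge_eq_zero B.absorbent_unitSet B.bounded_unitSet

instance (B : Disk E) : NormedAddCommGroup B.Space := NormedAddCommGroup.ofCore B.normedSpaceCore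

instance (B : Disk E) : NormedSpace ℝ B.Space := NormedSpace.ofCore B.normedSpaceCore

end Norm
end Disk

/-- A convenient vector space: a (Hausdorff real) locally convex space that is `c^∞`-complete,
i.e. `E_B` is a Banach space for every closed absolutely convex bounded `B ⊆ E`. -/
def IsConvenient (E : Type*) [AddCommGroup E] [Module ℝ E] [TopologicalSpace E]
    [IsTopologicalAddGroup E] [ContinuousSMul ℝ E] [T2Space E] : Prop :=
  LocallyConvexSpace ℝ E ∧ ∀ B : Disk E, CompleteSpace B.Space

section Smooth

variable {E F : Type*} [AddCommGroup E] [Module ℝ E] [TopologicalSpace E]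
  [AddCommGroup F] [Module ℝ F] [TopologicalSpace F]

/-- A smooth curve in a topological vector space: all iterated derivatives `d k`, defined as
limits of difference quotients, exist. -/
def IsSmoothCurve (c : ℝ → E) : Prop :=
  ∃ d : ℕ → ℝ → E, d 0 = c ∧
    ∀ k t, Tendsto (slope (d k) t) (𝓝[≠] t) (𝓝 (d (k + 1) t))

/-- Openness in the `c^∞`-topology, the final topology with respect to all smooth curves. -/
def IsCInftyOpen (U : Set E) : Prop :=
  ∀ c : ℝ → E, IsSmoothCurve c → IsOpen (c ⁻¹' U)

/-- `f ∈ C^∞(U, F)`: the map `f` takes smooth curves in `U` to smooth curves in `F`. -/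
def IsSmoothOn (f : E → F) (U : Set E) : Prop :=
  ∀ c : ℝ → E, IsSmoothCurve c → (∀ t, c t ∈ U) → IsSmoothCurve (f ∘ c)

end Smooth

/-- The two types of Denjoy--Carleman classes: `C^(M)` (Beurling) and `C^{M}` (Roumieu). -/
inductive ClassType
  | beurling
  | roumieu

/-- `f ∈ C^[M](U, H)` for an open subset `U` of a normed space: `f` is infinitely often
Fréchet differentiable on `U` and for every compact `K ⊆ U` and all (Beurling), respectively
some (Roumieu), `ρ > 0` the numbers `‖f^(k)(x)‖ / (k! ρ^k M_k)`, `x ∈ K`, `k ∈ ℕ`, are bounded. -/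
def IsNormedClass {G H : Type*} [NormedAddCommGroup G] [NormedSpace ℝ G]
    [NormedAddCommGroup H] [NormedSpace ℝ H]
    (τ : ClassType) (M : ℕ → ℝ) (f : G → H) (U : Set G) : Prop :=
  ContDiffOn ℝ ∞ f U ∧ ∀ K : Set G, IsCompact K → K ⊆ U →
    match τ with
    | .beurling => ∀ ρ : ℝ, 0 < ρ → ∃ C : ℝ, ∀ x ∈ K, ∀ k : ℕ,
        ‖iteratedFDerivWithin ℝ k f U x‖ / ((k.factorial : ℝ) * ρ ^ k * M k) ≤ C
    | .roumieu => ∃ ρ : ℝ, 0 < ρ ∧ ∃ C : ℝ, ∀ x ∈ K, ∀ k : ℕ,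
        ‖iteratedFDerivWithin ℝ k f U x‖ / ((k.factorial : ℝ) * ρ ^ k * M k) ≤ C

/-- `f ∈ C^[M](U, F)` for a `c^∞`-open subset `U` of a convenient vector space `E` and a
convenient vector space `F`: `f` is smooth on `U` and `ℓ ∘ f ∘ i_B ∈ C^[M](U_B, ℝ)`,
`U_B = i_B⁻¹(U)`, for every continuous linear functional `ℓ` on `F` and every closed
absolutely convex bounded `B ⊆ E`. -/
def IsClass {E F : Type*} [AddCommGroup E] [Module ℝ E] [TopologicalSpace E]
    [IsTopologicalAddGroup E] [ContinuousSMul ℝ E] [T2Space E]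
    [AddCommGroup F] [Module ℝ F] [TopologicalSpace F]
    (τ : ClassType) (M : ℕ → ℝ) (f : E → F) (U : Set E) : Prop :=
  IsSmoothOn f U ∧ ∀ (ℓ : F →L[ℝ] ℝ) (B : Disk E),
    IsNormedClass τ M (fun x : B.Space => ℓ (f (B.incl x))) (B.incl ⁻¹' U)

/-- A `C^[M]` Banach plot in `E`: a `C^[M]` map `c : D → E` on the open unit ball `D` of a
Banach space `G`. (Only the values of `c` on `D` matter.) -/
def IsPlot {G E : Type*} [NormedAddCommGroup G] [NormedSpace ℝ G] [CompleteSpace G]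
    [AddCommGroup E] [Module ℝ E] [TopologicalSpace E]
    (τ : ClassType) (M : ℕ → ℝ) (c : G → E) : Prop :=
  IsClass τ M c (Metric.ball 0 1)

/-- Log-convex weight sequences, with the standing assumption `M_0 = 1 ≤ M_1`. -/
structure IsLogConvexWeight (M : ℕ → ℝ) : Prop where
  pos : ∀ k, 0 < M k
  zero : M 0 = 1
  one_le : 1 ≤ M 1
  logConvex : ∀ k, M (k + 1) ^ 2 ≤ M k * M (k + 2)

end DenjoyCarleman

end

/-! The estimate is Faà di Bruno's formula combined with log-convexity: the latter gives `M j * ∏ M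
(α i) ≤ M 1 ^ j * M n` for a partition of `n` into `j` blocks of sizes `α i`, and the factorials sum
to a geometric factor (`sum_composition_le`). Both classes are treated at once by testing growth
against `k! u_k ^ k M_k` for all admissible `u`; every such `w` splits as required by composition
(`IsAdmissible.exists_factorization`).

The difficulty is that `c` is controlled only through functionals and only on compact sets, so it
need not be locally smooth into one Banach space `E_B`. For compact `K` the bounds on all `ℓ ∘ c`
define a weak disk, bounded by Mackey's theorem, whose span contains the derivatives of `c` at
points of `K`. If `K` is convex, the mean value theorem makes `c(K)` compact in this span, and the
hypothesis on `f` applies there. To have an honest chain rule at a point of `K`, `c` is restricted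
to a finite-dimensional subspace, where closed balls are compact; this restriction is smooth into
the span of a larger weak disk. The directions that enter Faà di Bruno's formula come from the
smaller space, so the constants depend only on `K` (`exists_iteratedDir_comp_bound`).

This bounds the iterated directional derivatives of `ℓ ∘ f ∘ c` on compact sets for each `ℓ`. They
are values at `ℓ` of elements of the bidual of `F`, so uniform boundedness makes the bounds uniform
for `‖ℓ‖ ≤ 1`. A bound on all convergent sequences is a local bound, and locally bounded directional
derivatives, tested by a norming family of functionals, force Fréchet smoothness
(`IsTower.contDiffOn`). -/

namespace DenjoyCarleman

universe u v w

/-! ### Consequences of log-convexity -/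

section Weights

/-- The quotients `M (k + 1) / M k` increase with `k`; cross-multiplication avoids divisions. -/
theorem IsLogConvexWeight.mul_le_mul_add {M : ℕ → ℝ} (hM : IsLogConvexWeight M) (a n : ℕ) :
    M (a + 1) * M (a + n) ≤ M a * M (a + n + 1) := by
  induction n with
  | zero => rw [add_zero, mul_comm]
  | succ n ih =>
    have h0 := hM.pos (a + n + 1)
    have h1 := hM.pos (a + n + 2)
    have h2 := hM.pos (a + 1)
    have h3 := hM.logConvex (a + n)
    refine le_of_mul_le_mul_right ?_ h0
    calc M (a + 1) * M (a + (n + 1)) * M (a + n + 1)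
        = M (a + 1) * M (a + n + 1) ^ 2 := by rw [← add_assoc]; ring
      _ ≤ M (a + 1) * (M (a + n) * M (a + n + 2)) := by gcongr
      _ = M (a + 1) * M (a + n) * M (a + n + 2) := by ring
      _ ≤ M a * M (a + n + 1) * M (a + n + 2) := by gcongr
      _ = M a * M (a + (n + 1) + 1) * M (a + n + 1) := by
        rw [show a + (n + 1) + 1 = a + n + 2 by ring]; ring

theorem IsLogConvexWeight.mul_succ_le {M : ℕ → ℝ} (hM : IsLogConvexWeight M) (a n : ℕ) :
    M (a + 1) * M (n + 1) ≤ M 1 * M (n + a + 1) := by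
  induction a with
  | zero => simp
  | succ a ih =>
    have h0 := hM.pos (a + 1)
    have h1 := hM.pos (a + 2)
    have h2 := hM.pos 1
    have h3 := hM.mul_le_mul_add (a + 1) n
    refine le_of_mul_le_mul_right ?_ h0
    calc M (a + 1 + 1) * M (n + 1) * M (a + 1)
        = M (a + 2) * (M (a + 1) * M (n + 1)) := by ring_nf
      _ ≤ M (a + 2) * (M 1 * M (n + a + 1)) := by gcongr
      _ = M 1 * (M (a + 1 + 1) * M (a + 1 + n)) := by
        rw [show a + 1 + n = n + a + 1 by ring]; ring
      _ ≤ M 1 * (M (a + 1) * M (a + 1 + n + 1)) := by gcongr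
      _ = M 1 * M (n + (a + 1) + 1) * M (a + 1) := by
        rw [show a + 1 + n + 1 = n + (a + 1) + 1 by ring]; ring

/-- Each block is absorbed by one use of `mul_succ_le`, at the price of a factor `M 1`. The offset
`m` collects the blocks already absorbed, which makes the induction on `n` close. -/
theorem IsLogConvexWeight.mul_prod_le {M : ℕ → ℝ} (hM : IsLogConvexWeight M) (n : ℕ) :
    ∀ (m : ℕ) (α : Fin n → ℕ), (∀ i, 0 < α i) →
      M (m + n) * ∏ i, M (α i) ≤ M 1 ^ n * M (m + ∑ i, α i) := by
  induction n with
  | zero => intro m α _; simp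
  | succ n ih =>
    intro m α hα
    rw [Fin.prod_univ_succ, Fin.sum_univ_succ]
    obtain ⟨a, ha⟩ : ∃ a, α 0 = a + 1 := ⟨α 0 - 1, by have := hα 0; omega⟩
    have h1 := hM.mul_succ_le a (m + n)
    have h2 := ih (m + α 0) (fun i => α i.succ) fun i => hα _
    have h3 : 0 < ∏ i : Fin n, M (α i.succ) := Finset.prod_pos fun i _ => hM.pos _
    have h4 := hM.pos 1
    calc M (m + (n + 1)) * (M (α 0) * ∏ i : Fin n, M (α i.succ))
        = (M (a + 1) * M (m + n + 1)) * ∏ i : Fin n, M (α i.succ) := by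
          rw [ha, ← add_assoc]; ring
      _ ≤ (M 1 * M (m + n + a + 1)) * ∏ i : Fin n, M (α i.succ) := by gcongr
      _ = M 1 * (M (m + α 0 + n) * ∏ i : Fin n, M (α i.succ)) := by
          rw [ha, show m + (a + 1) + n = m + n + a + 1 by ring]; ring
      _ ≤ M 1 * (M 1 ^ n * M (m + α 0 + ∑ i : Fin n, α i.succ)) := by gcongr
      _ = _ := by rw [← add_assoc]; ring

end Weights

/-! ### Sums over ordered partitions in Faà di Bruno's formula -/

section Partitions

theorem _root_.OrderedFinpartition.sum_partSize {n : ℕ} (c : OrderedFinpartition n) :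
    ∑ i, c.partSize i = n := by
  have := Fintype.card_congr c.equivSigma
  simpa using this

/-- The weight `j! α₁! ⋯ α_j! x ^ j` of an ordered partition with `j` blocks of sizes `α_i`. -/
def partitionWeight (x : ℝ) {n : ℕ} (c : OrderedFinpartition n) : ℝ :=
  (c.length.factorial : ℝ) * (∏ i, ((c.partSize i).factorial : ℝ)) * x ^ c.length

theorem partitionWeight_extendLeft (x : ℝ) {n : ℕ} (c : OrderedFinpartition n) :
    partitionWeight x c.extendLeft = (c.length + 1) * x * partitionWeight x c := by
  have : ∏ i : Fin (c.length + 1),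
      (((Fin.cons 1 c.partSize : Fin (c.length + 1) → ℕ) i).factorial : ℝ)
      = ∏ i, ((c.partSize i).factorial : ℝ) := by
    rw [Fin.prod_univ_succ]; simp
  unfold partitionWeight
  calc _ = (((c.length + 1).factorial : ℕ) : ℝ) * (∏ i : Fin (c.length + 1),
        (((Fin.cons 1 c.partSize : Fin (c.length + 1) → ℕ) i).factorial : ℝ)) *
          x ^ (c.length + 1) := rfl
    _ = _ := by rw [this, Nat.factorial_succ]; push_cast; ring

theorem partitionWeight_extendMiddle (x : ℝ) {n : ℕ} (c : OrderedFinpartition n)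
    (k : Fin c.length) :
    partitionWeight x (c.extendMiddle k) = (c.partSize k + 1) * partitionWeight x c := by
  have : ∏ i : Fin c.length,
      (((Function.update c.partSize k (c.partSize k + 1)) i).factorial : ℝ)
      = (c.partSize k + 1) * ∏ i, ((c.partSize i).factorial : ℝ) := by
    rw [← Finset.mul_prod_erase _ _ (Finset.mem_univ k),
      ← Finset.mul_prod_erase Finset.univ (fun i => ((c.partSize i).factorial : ℝ))
        (Finset.mem_univ k)]
    rw [Function.update_self, Nat.factorial_succ, Finset.prod_congr rfl (g := fun i =>
      ((c.partSize i).factorial : ℝ))]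
    · push_cast; ring
    · intro i hi
      rw [Function.update_of_ne (Finset.ne_of_mem_erase hi)]
  unfold partitionWeight
  calc _ = ((c.length.factorial : ℕ) : ℝ) * (∏ i : Fin c.length,
        (((Function.update c.partSize k (c.partSize k + 1)) i).factorial : ℝ)) *
          x ^ c.length := rfl
    _ = _ := by rw [this]; ring

theorem partitionWeight_nonneg {x : ℝ} (hx : 0 ≤ x) {n : ℕ} (c : OrderedFinpartition n) :
    0 ≤ partitionWeight x c := by
  unfold partitionWeight; positivity

/-- A partition of `n + 1` arises from one of `n` by adding a singleton block or enlarging a block.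
The weight is multiplied by `(length + 1) * x` or by `partSize + 1`, and these factors add up to at
most `(n + 1) * (2 + x)`. -/
theorem sum_partitionWeight_le {x : ℝ} (hx : 0 ≤ x) (n : ℕ) :
    ∑ c : OrderedFinpartition n, partitionWeight x c ≤ n.factorial * (2 + x) ^ n := by
  induction n with
  | zero =>
    rw [Fintype.sum_unique]
    simp [partitionWeight, default]
  | succ n ih =>
    rw [← (OrderedFinpartition.extendEquiv n).sum_comp, Fintype.sum_sigma]
    have key : ∀ c : OrderedFinpartition n, ∑ o : Option (Fin c.length),
        partitionWeight x (OrderedFinpartition.extendEquiv n ⟨c, o⟩)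
          ≤ (n + 1) * (2 + x) * partitionWeight x c := by
      intro c
      rw [Fintype.sum_option]
      simp only [OrderedFinpartition.extendEquiv_apply, OrderedFinpartition.extend_none,
        OrderedFinpartition.extend_some, partitionWeight_extendLeft, partitionWeight_extendMiddle]
      rw [← Finset.sum_mul, ← add_mul]
      refine mul_le_mul_of_nonneg_right ?_ (partitionWeight_nonneg hx c)
      have h1 : ∑ i, (c.partSize i : ℝ) = n := by exact_mod_cast c.sum_partSize
      have h2 : (c.length : ℝ) ≤ n := by exact_mod_cast c.length_le
      rw [Finset.sum_add_distrib, h1]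
      simp only [Finset.sum_const, Finset.card_univ, Fintype.card_fin, nsmul_eq_mul, mul_one]
      nlinarith
    calc _ ≤ ∑ c : OrderedFinpartition n, (n + 1) * (2 + x) * partitionWeight x c :=
          Finset.sum_le_sum fun c _ => key c
      _ = (n + 1) * (2 + x) * ∑ c : OrderedFinpartition n, partitionWeight x c := by
          rw [Finset.mul_sum]
      _ ≤ (n + 1) * (2 + x) * (n.factorial * (2 + x) ^ n) := by gcongr
      _ = _ := by rw [Nat.factorial_succ]; push_cast; ring

/-- The estimate behind the stability of Denjoy--Carleman classes under composition. -/
theorem sum_composition_le {M : ℕ → ℝ} (hM : IsLogConvexWeight M) {u v w : ℕ → ℝ}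
    (hu : Monotone u) (hu0 : ∀ k, 0 < u k) (hv : Monotone v) (hv0 : ∀ k, 0 < v k)
    {n : ℕ} (huvw : (2 + M 1 * v n) * u n ≤ w n) :
    ∑ c : OrderedFinpartition n, ((c.length.factorial : ℝ) * v c.length ^ c.length * M c.length *
      ∏ i, ((c.partSize i).factorial * u (c.partSize i) ^ (c.partSize i) * M (c.partSize i)))
      ≤ n.factorial * w n ^ n * M n := by
  have hM1 := hM.pos 1
  have hun := hu0 n
  have hvn := hv0 n
  have hMn := hM.pos n
  have key : ∀ c : OrderedFinpartition n,
      ((c.length.factorial : ℝ) * v c.length ^ c.length * M c.length *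
      ∏ i, ((c.partSize i).factorial * u (c.partSize i) ^ (c.partSize i) * M (c.partSize i)))
      ≤ u n ^ n * M n * partitionWeight (M 1 * v n) c := by
    intro c
    have h1 : ∏ i, u (c.partSize i) ^ (c.partSize i) ≤ u n ^ n := by
      calc _ ≤ ∏ i, u n ^ (c.partSize i) := by
            refine Finset.prod_le_prod (fun i _ => (pow_pos (hu0 _) _).le) fun i _ => ?_
            exact pow_le_pow_left₀ (hu0 _).le (hu (c.partSize_le i)) _
        _ = u n ^ n := by rw [Finset.prod_pow_eq_pow_sum, c.sum_partSize]
    have h2 : v c.length ^ c.length ≤ v n ^ c.length :=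
      pow_le_pow_left₀ (hv0 _).le (hv c.length_le) _
    have h3 : M c.length * ∏ i, M (c.partSize i) ≤ M 1 ^ c.length * M n := by
      have := hM.mul_prod_le c.length 0 c.partSize c.partSize_pos
      simpa [c.sum_partSize] using this
    have h4 : 0 ≤ ∏ i, ((c.partSize i).factorial : ℝ) := Finset.prod_nonneg fun i _ => by positivity
    have h5 : 0 ≤ ∏ i, u (c.partSize i) ^ (c.partSize i) :=
      Finset.prod_nonneg fun i _ => (pow_pos (hu0 _) _).le
    have h6 : 0 ≤ M c.length * ∏ i, M (c.partSize i) :=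
      mul_nonneg (hM.pos _).le (Finset.prod_nonneg fun i _ => (hM.pos _).le)
    rw [Finset.prod_mul_distrib, Finset.prod_mul_distrib]
    calc _ = (c.length.factorial * ∏ i, ((c.partSize i).factorial : ℝ)) *
          (v c.length ^ c.length * (∏ i, u (c.partSize i) ^ (c.partSize i)) *
          (M c.length * ∏ i, M (c.partSize i))) := by ring
      _ ≤ (c.length.factorial * ∏ i, ((c.partSize i).factorial : ℝ)) *
          (v n ^ c.length * u n ^ n * (M 1 ^ c.length * M n)) := by gcongr
      _ = _ := by unfold partitionWeight; rw [mul_pow]; ring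
  calc _ ≤ ∑ c : OrderedFinpartition n, u n ^ n * M n * partitionWeight (M 1 * v n) c :=
        Finset.sum_le_sum fun c _ => key c
    _ = u n ^ n * M n * ∑ c : OrderedFinpartition n, partitionWeight (M 1 * v n) c := by
        rw [Finset.mul_sum]
    _ ≤ u n ^ n * M n * (n.factorial * (2 + M 1 * v n) ^ n) := by
        gcongr; exact sum_partitionWeight_le (by positivity) n
    _ = n.factorial * ((2 + M 1 * v n) * u n) ^ n * M n := by rw [mul_pow]; ring
    _ ≤ _ := by gcongr

end Partitions

/-! ### Beurling and Roumieu bounds described by admissible sequences -/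

section Admissible

/-- A monotone sequence `u` such that `k! u_k ^ k M_k` dominates the derivatives of `C^[M]` maps:
a constant in the Beurling case, a sequence tending to infinity in the Roumieu case. -/
structure IsAdmissible (τ : ClassType) (u : ℕ → ℝ) : Prop where
  mono : Monotone u
  pos : ∀ k, 0 < u k
  growth : match τ with
    | .beurling => ∀ k, u k = u 0
    | .roumieu => Tendsto u atTop atTop

/-- The bounds in the definition of the classes `C^[M]`. -/
def IsClassBound {X : Type*} (τ : ClassType) (M : ℕ → ℝ) (K : Set X) (N : X → ℕ → ℝ) : Prop :=
  match τ with
    | .beurling => ∀ ρ : ℝ, 0 < ρ → ∃ C : ℝ, ∀ x ∈ K, ∀ k : ℕ,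
        N x k / ((k.factorial : ℝ) * ρ ^ k * M k) ≤ C
    | .roumieu => ∃ ρ : ℝ, 0 < ρ ∧ ∃ C : ℝ, ∀ x ∈ K, ∀ k : ℕ,
        N x k / ((k.factorial : ℝ) * ρ ^ k * M k) ≤ C

theorem isNormedClass_iff {G H : Type*} [NormedAddCommGroup G] [NormedSpace ℝ G]
    [NormedAddCommGroup H] [NormedSpace ℝ H] {τ : ClassType} {M : ℕ → ℝ} {f : G → H} {U : Set G} :
    IsNormedClass τ M f U ↔ ContDiffOn ℝ ∞ f U ∧ ∀ K : Set G, IsCompact K → K ⊆ U →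
      IsClassBound τ M K fun x k => ‖iteratedFDerivWithin ℝ k f U x‖ := Iff.rfl

variable {X : Type*} {τ : ClassType} {M : ℕ → ℝ} {K : Set X} {N : X → ℕ → ℝ}

theorem IsClassBound.le_admissible (hN : IsClassBound τ M K N) (hM : ∀ k, 0 < M k) {u : ℕ → ℝ}
    (hu : IsAdmissible τ u) :
    ∃ C : ℝ, 0 ≤ C ∧ ∀ x ∈ K, ∀ k, N x k ≤ C * (k.factorial * u k ^ k * M k) := by
  cases τ with
  | beurling =>
    obtain ⟨C, hC⟩ := hN (u 0) (hu.pos 0)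
    refine ⟨max C 0, le_max_right _ _, fun x hx k => ?_⟩
    have h := hC x hx k
    have := hM k
    have := hu.pos 0
    have hk : u k = u 0 := hu.growth k
    rw [div_le_iff₀ (by positivity)] at h
    rw [hk]
    refine h.trans ?_
    gcongr
    exact le_max_left _ _
  | roumieu =>
    obtain ⟨ρ, hρ, C, hC⟩ := hN
    have hlim : Tendsto u atTop atTop := hu.growth
    obtain ⟨n, hn⟩ := eventually_atTop.1 (hlim.eventually_ge_atTop ρ)
    -- `D` pays for the indices below `n`, the only ones where `u k < ρ` is possible.
    set D : ℝ := max 1 (ρ / u 0) ^ n with hD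
    have hu0 := hu.pos 0
    have hD0 : 0 < D := by positivity
    have key : ∀ k, ρ ^ k ≤ D * u k ^ k := by
      intro k
      have huk := hu.pos k
      rcases le_total n k with h | h
      · have : 1 ≤ D := one_le_pow₀ (le_max_left _ _)
        calc ρ ^ k ≤ u k ^ k := pow_le_pow_left₀ hρ.le (hn k h) _
          _ ≤ D * u k ^ k := le_mul_of_one_le_left (by positivity) this
      · rw [← div_le_iff₀ (by positivity), ← div_pow]
        calc (ρ / u k) ^ k ≤ (max 1 (ρ / u 0)) ^ k := by
              gcongr
              refine le_trans ?_ (le_max_right _ _)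
              have := hu.mono (Nat.zero_le k)
              gcongr
          _ ≤ D := pow_le_pow_right₀ (le_max_left _ _) h
    refine ⟨max C 0 * D, by positivity, fun x hx k => ?_⟩
    have h := hC x hx k
    have h1 := hM k
    rw [div_le_iff₀ (by positivity)] at h
    calc N x k ≤ max C 0 * (k.factorial * ρ ^ k * M k) :=
          h.trans (by gcongr; exact le_max_left _ _)
      _ ≤ max C 0 * (k.factorial * (D * u k ^ k) * M k) := by gcongr; exact key k
      _ = _ := by ring

/-- If the running maximum `p` of the roots `a k ^ (1 / k)` were unbounded, `√p` would be
admissible. At an index `i` where a maximum above `1` is attained, `a i = p i ^ i ≤ C * √(p i) ^ i`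
then bounds `√(p i)` by `C`, so `p` is bounded after all. -/
theorem exists_geometric_bound {a : ℕ → ℝ} (ha : ∀ k, 0 ≤ a k)
    (h : ∀ u, IsAdmissible .roumieu u → ∃ C, ∀ k, a k ≤ C * u k ^ k) :
    ∃ ρ : ℝ, 0 < ρ ∧ ∃ C, ∀ k, a k ≤ C * ρ ^ k := by
  set s : ℕ → ℝ := fun k => max 1 (a k ^ ((k : ℝ)⁻¹)) with hs
  set p : ℕ → ℝ := fun k => partialSups s k with hp
  have hs1 : ∀ k, 1 ≤ s k := fun k => le_max_left _ _
  have hsp : ∀ k, s k ≤ p k := fun k => le_partialSups s k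
  have hp1 : ∀ k, 1 ≤ p k := fun k => (hs1 k).trans (hsp k)
  have hpm : Monotone p := (partialSups s).monotone
  have hak : ∀ k, k ≠ 0 → a k ≤ s k ^ k := by
    intro k hk
    calc a k = (a k ^ ((k : ℝ)⁻¹)) ^ k := (Real.rpow_inv_natCast_pow (ha k) hk).symm
      _ ≤ s k ^ k := pow_le_pow_left₀ (Real.rpow_nonneg (ha k) _) (le_max_right _ _) _
  have hbdd : ∃ b, ∀ k, p k ≤ b := by
    rcases tendsto_atTop_of_monotone hpm with hlim | ⟨b, hb⟩
    swap
    · exact ⟨b, fun k => hpm.ge_of_tendsto hb k⟩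
    have hadm : IsAdmissible .roumieu fun k => √(p k) :=
      { mono := fun i j hij => Real.sqrt_le_sqrt (hpm hij)
        pos := fun k => Real.sqrt_pos.2 (one_pos.trans_le (hp1 k))
        growth := Real.tendsto_sqrt_atTop.comp hlim }
    obtain ⟨C₀, hC₀⟩ := h _ hadm
    set C := max C₀ 1
    refine ⟨C ^ 2, fun k => ?_⟩
    obtain ⟨i, hik, hi⟩ := exists_partialSups_eq s k
    have hpk : p k = s i := hi
    rw [hpk]
    rcases le_or_gt (s i) 1 with h1 | h1
    · exact h1.trans (one_le_pow₀ (le_max_right _ _))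
    have hi0 : i ≠ 0 := by
      rintro rfl
      simp [hs] at h1
    have hsi : s i = a i ^ ((i : ℝ)⁻¹) := by
      rw [hs]; refine max_eq_right ?_
      by_contra hcon
      rw [not_le] at hcon
      rw [hs] at h1
      simp only [max_eq_left hcon.le] at h1
      exact lt_irrefl _ h1
    have hai : s i ^ i = a i := by rw [hsi, Real.rpow_inv_natCast_pow (ha i) hi0]
    have hpi : p i = s i := le_antisymm (by rw [← hpk]; exact hpm hik) (hsp i)
    have h2 : s i ^ i ≤ C * √(s i) ^ i := by
      have := hC₀ i
      rw [← hai] at this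
      simp only [hpi] at this
      refine this.trans ?_
      gcongr
      exact le_max_left _ _
    have h3 : √(s i) ^ i ≤ C := by
      have h4 : 0 < √(s i) ^ i := pow_pos (Real.sqrt_pos.2 (by linarith)) _
      refine le_of_mul_le_mul_right ?_ h4
      rw [← mul_pow, Real.mul_self_sqrt (by linarith)]
      exact h2
    have h5 : √(s i) ≤ C := by
      refine le_trans ?_ h3
      exact le_self_pow₀ (Real.one_le_sqrt.2 h1.le) hi0
    calc s i = √(s i) ^ 2 := (Real.sq_sqrt (by linarith)).symm
      _ ≤ C ^ 2 := by gcongr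
  obtain ⟨b, hb⟩ := hbdd
  have hb0 : 0 < b := one_pos.trans_le ((hp1 0).trans (hb 0))
  refine ⟨b, hb0, max 1 (a 0), fun k => ?_⟩
  rcases eq_or_ne k 0 with rfl | hk
  · simp
  · calc a k ≤ s k ^ k := hak k hk
      _ ≤ b ^ k := pow_le_pow_left₀ (by linarith [hs1 k]) ((hsp k).trans (hb k)) _
      _ ≤ max 1 (a 0) * b ^ k := le_mul_of_one_le_left (by positivity) (le_max_left _ _)

/-- In the Roumieu case the geometric bound is applied to the suprema over `K`, so that one `ρ`
serves all points. -/
theorem isClassBound_of_forall_admissible (hM : ∀ k, 0 < M k) (hN : ∀ x k, 0 ≤ N x k)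
    (h : ∀ u, IsAdmissible τ u →
      ∃ C : ℝ, ∀ x ∈ K, ∀ k, N x k ≤ C * (k.factorial * u k ^ k * M k)) :
    IsClassBound τ M K N := by
  cases τ with
  | beurling =>
    intro ρ hρ
    obtain ⟨C, hC⟩ := h (fun _ => ρ) ⟨monotone_const, fun _ => hρ, fun _ => rfl⟩
    refine ⟨C, fun x hx k => ?_⟩
    have := hM k
    rw [div_le_iff₀ (by positivity)]
    exact hC x hx k
  | roumieu =>
    set a : ℕ → ℝ := fun k => ⨆ x : K, N x k / (k.factorial * M k) with ha
    have hpos : ∀ k : ℕ, 0 < (k.factorial * M k : ℝ) := fun k => by have := hM k; positivity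
    have hle : ∀ u, IsAdmissible .roumieu u → ∃ C : ℝ, 0 ≤ C ∧ ∀ k (x : K),
        N x k / (k.factorial * M k) ≤ C * u k ^ k := by
      intro u hu
      obtain ⟨C, hC⟩ := h u hu
      refine ⟨max C 0, le_max_right _ _, fun k x => ?_⟩
      have := hpos k
      have := hu.pos k
      rw [div_le_iff₀ (hpos k)]
      calc _ ≤ C * (k.factorial * u k ^ k * M k) := hC x x.2 k
        _ = C * (u k ^ k * (k.factorial * M k)) := by ring
        _ ≤ max C 0 * (u k ^ k * (k.factorial * M k)) := by gcongr; exact le_max_left _ _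
        _ = _ := by ring
    -- Any single admissible sequence shows that the suprema are finite; otherwise the real `⨆`
    -- would carry no information.
    have hadm : IsAdmissible .roumieu fun k => (k : ℝ) + 1 :=
      { mono := fun i j hij => by simpa using hij
        pos := fun k => by positivity
        growth := tendsto_atTop_add_const_right _ _ tendsto_natCast_atTop_atTop }
    have hbdd : ∀ k, BddAbove (range fun x : K => N x k / (k.factorial * M k)) := by
      intro k
      obtain ⟨C, -, hC⟩ := hle _ hadm
      exact ⟨_, forall_mem_range.2 (hC k)⟩
    obtain ⟨ρ, hρ, C, hC⟩ := exists_geometric_bound (a := a)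
      (fun k => Real.iSup_nonneg fun x => div_nonneg (hN _ _) (hpos k).le) (by
        intro u hu
        obtain ⟨C, hC0, hC⟩ := hle u hu
        have := hu.pos
        exact ⟨C, fun k => Real.iSup_le (hC k) (mul_nonneg hC0 (pow_pos (hu.pos k) k).le)⟩)
    refine ⟨ρ, hρ, C, fun x hx k => ?_⟩
    have h1 : N x k / (k.factorial * M k) ≤ C * ρ ^ k := (le_ciSup (hbdd k) ⟨x, hx⟩).trans (hC k)
    have := hM k
    rw [div_le_iff₀ (hpos k)] at h1
    rw [div_le_iff₀ (by positivity)]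
    calc _ ≤ _ := h1
      _ = _ := by ring

/-- Take `v = √w` and `u = a * √w`. Since `√(w k) ≥ √(w 0)`, the summand `2` is at most `(2 / √(w
0)) * √(w k)`, which dictates `a`. -/
theorem IsAdmissible.exists_factorization {w : ℕ → ℝ} (hw : IsAdmissible τ w) {m : ℝ}
    (hm : 0 < m) :
    ∃ u v, IsAdmissible τ u ∧ IsAdmissible τ v ∧ ∀ k, (2 + m * v k) * u k ≤ w k := by
  have hw0 := hw.pos 0
  set a : ℝ := (2 / √(w 0) + m)⁻¹ with ha
  have ha0 : 0 < a := by positivity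
  have hv : IsAdmissible τ fun k => √(w k) :=
    { mono := fun i j hij => Real.sqrt_le_sqrt (hw.mono hij)
      pos := fun k => Real.sqrt_pos.2 (hw.pos k)
      growth := by
        cases τ with
        | beurling => exact fun k => congrArg _ (hw.growth k)
        | roumieu => exact Real.tendsto_sqrt_atTop.comp hw.growth }
  have hu : IsAdmissible τ fun k => a * √(w k) :=
    { mono := fun i j hij => mul_le_mul_of_nonneg_left (hv.mono hij) ha0.le
      pos := fun k => mul_pos ha0 (hv.pos k)
      growth := by
        cases τ with
        | beurling => exact fun k => congrArg (a * ·) (hv.growth k)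
        | roumieu => exact Tendsto.const_mul_atTop ha0 hv.growth }
  refine ⟨_, _, hu, hv, fun k => ?_⟩
  have hwk := hw.pos k
  have h0 : √(w 0) ≤ √(w k) := hv.mono (Nat.zero_le k)
  have h1 : 2 + m * √(w k) ≤ a⁻¹ * √(w k) := by
    rw [ha, inv_inv, add_mul]
    gcongr
    rw [div_mul_eq_mul_div, le_div_iff₀ (by positivity)]
    gcongr
  calc (2 + m * √(w k)) * (a * √(w k)) ≤ a⁻¹ * √(w k) * (a * √(w k)) := by gcongr
    _ = √(w k) * √(w k) := by field_simp
    _ = w k := Real.mul_self_sqrt hwk.le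

end Admissible

/-! ### Fréchet smoothness from directional derivatives tested by functionals -/

section Tower

variable {V : Type*} [NormedAddCommGroup V] [NormedSpace ℝ V]

theorem abs_sub_le_of_tower {τ : V → List V → ℝ} {D S : Set V}
    (hder : ∀ x ∈ D, ∀ h L, HasDerivAt (fun s : ℝ => τ (x + s • h) L) (τ x (h :: L)) 0)
    (hSD : S ⊆ D) {h : V} {L : List V} {C : ℝ} (hC : ∀ y ∈ S, |τ y (h :: L)| ≤ C)
    (hS : Convex ℝ S) {x : V} (hx : x ∈ S) (hxh : x + h ∈ S) : |τ (x + h) L - τ x L| ≤ C := by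
  have hmem : ∀ s ∈ Icc (0 : ℝ) 1, x + s • h ∈ S := fun s hs => hS.add_smul_mem hx hxh hs
  have key : ∀ s ∈ Icc (0 : ℝ) 1, HasDerivWithinAt (fun s : ℝ => τ (x + s • h) L)
      (τ (x + s • h) (h :: L)) (Icc 0 1) s := by
    intro s hs
    have := hder _ (hSD (hmem s hs)) h L
    have h2 := HasDerivAt.comp_sub_const (f := fun t : ℝ => τ (x + s • h + t • h) L)
      (x := s) (a := s) (f' := τ (x + s • h) (h :: L)) (by simpa using this)
    refine (h2.congr_of_eventuallyEq (Eventually.of_forall fun t => ?_)).hasDerivWithinAt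
    simp only
    congr 1
    module
  have := norm_image_sub_le_of_norm_deriv_le_segment_01' key fun s hs =>
    (Real.norm_eq_abs _).trans_le (hC _ (hmem s ⟨hs.1, hs.2.le⟩))
  simpa using this

theorem abs_taylor_le_of_tower {τ : V → List V → ℝ} {D S : Set V}
    (hder : ∀ x ∈ D, ∀ h L, HasDerivAt (fun s : ℝ => τ (x + s • h) L) (τ x (h :: L)) 0)
    (hSD : S ⊆ D) {h : V} {C : ℝ} (hC : ∀ y ∈ S, |τ y [h, h]| ≤ C)
    (hS : Convex ℝ S) {x : V} (hx : x ∈ S) (hxh : x + h ∈ S) :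
    |τ (x + h) [] - τ x [] - τ x [h]| ≤ C := by
  have hmem : ∀ s ∈ Icc (0 : ℝ) 1, x + s • h ∈ S := fun s hs => hS.add_smul_mem hx hxh hs
  have hC0 : 0 ≤ C := (abs_nonneg _).trans (hC x hx)
  have hhom : ∀ s ∈ Icc (0 : ℝ) 1, |τ (x + s • h) [h] - τ x [h]| ≤ C := by
    intro s hs
    have hd : ∀ t ∈ Icc (0 : ℝ) s, HasDerivWithinAt (fun s : ℝ => τ (x + s • h) [h])
      (τ (x + t • h) [h, h]) (Icc 0 s) t := by
      intro t ht
      have := hder _ (hSD (hmem t ⟨ht.1, ht.2.trans hs.2⟩)) h [h]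
      have h2 := HasDerivAt.comp_sub_const (f := fun r : ℝ => τ (x + t • h + r • h) [h])
        (x := t) (a := t) (f' := τ (x + t • h) [h, h]) (by simpa using this)
      refine (h2.congr_of_eventuallyEq (Eventually.of_forall fun t => ?_)).hasDerivWithinAt
      simp only
      congr 1
      module
    have := norm_image_sub_le_of_norm_deriv_le_segment' hd (C := C) (fun t ht =>
      (Real.norm_eq_abs _).trans_le (hC _ (hmem t ⟨ht.1, ht.2.le.trans hs.2⟩))) s ⟨hs.1, le_rfl⟩
    simp only [zero_smul, add_zero, sub_zero, Real.norm_eq_abs] at this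
    exact this.trans (mul_le_of_le_one_right hC0 hs.2)
  have key : ∀ s ∈ Icc (0 : ℝ) 1, HasDerivWithinAt (fun s : ℝ => τ (x + s • h) [] - s * τ x [h])
      (τ (x + s • h) [h] - τ x [h]) (Icc 0 1) s := by
    intro s hs
    have := hder _ (hSD (hmem s hs)) h []
    have h2 := HasDerivAt.comp_sub_const (f := fun t : ℝ => τ (x + s • h + t • h) [])
      (x := s) (a := s) (f' := τ (x + s • h) [h]) (by simpa using this)
    have h3 := h2.sub ((hasDerivAt_id s).mul_const (τ x [h]))
    rw [one_mul] at h3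
    refine (h3.congr_of_eventuallyEq (Eventually.of_forall fun t => ?_)).hasDerivWithinAt
    simp only [Pi.sub_apply, id]
    congr 2
    module
  have := norm_image_sub_le_of_norm_deriv_le_segment_01' key fun s hs =>
    (Real.norm_eq_abs _).trans_le (hhom s ⟨hs.1, hs.2.le⟩)
  simp only [one_smul, one_mul, zero_smul, add_zero, zero_mul, sub_zero, Real.norm_eq_abs] at this
  rwa [sub_right_comm] at this

theorem tower_smul {τ : V → List V → ℝ} {D : Set V}
    (hder : ∀ x ∈ D, ∀ h L, HasDerivAt (fun s : ℝ => τ (x + s • h) L) (τ x (h :: L)) 0)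
    {x : V} (hx : x ∈ D) (a : ℝ) (h : V) (L : List V) :
    τ x ((a • h) :: L) = a * τ x (h :: L) := by
  refine (hder x hx (a • h) L).unique ?_
  have h1 := hder x hx h L
  have h2 : HasDerivAt (fun s : ℝ => s * a) a 0 := by
    simpa using (hasDerivAt_id (0 : ℝ)).mul_const a
  have h3 := HasDerivAt.comp (0 : ℝ) (h₂ := fun s : ℝ => τ (x + s • h) L)
    (h₂' := τ x (h :: L)) (by simpa using h1) h2
  rw [mul_comm]
  simpa [Function.comp_def, mul_smul] using h3

/-- Second-order Taylor estimates compare the step `t • (v + w)` with the steps `t • v` and then `t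
• w`. The defect of additivity, multiplied by `t`, is `O(t ^ 2)`, hence zero. -/
theorem tower_add {τ : V → List V → ℝ} {D S : Set V}
    (hder : ∀ x ∈ D, ∀ h L, HasDerivAt (fun s : ℝ => τ (x + s • h) L) (τ x (h :: L)) 0)
    (hSD : S ⊆ D) {R : ℝ} (hR : ∀ y ∈ S, ∀ v w, |τ y [v, w]| ≤ R * (‖v‖ * ‖w‖))
    (hS : Convex ℝ S) {x : V} (hx : S ∈ 𝓝 x) (v w : V) :
    τ x [v + w] = τ x [v] + τ x [w] := by
  have hxS : x ∈ S := mem_of_mem_nhds hx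
  have hxD := hSD hxS
  set e := τ x [v + w] - τ x [v] - τ x [w] with he
  set C := R * (‖v + w‖ * ‖v + w‖) + R * (‖v‖ * ‖v‖) + R * (‖w‖ * ‖w‖) + R * (‖v‖ * ‖w‖) with hCdef
  have h1 : ∀ᶠ t : ℝ in 𝓝[>] 0, x + t • v ∈ S ∧ x + t • v + t • w ∈ S := by
    have c1 : Tendsto (fun t : ℝ => x + t • v) (𝓝 0) (𝓝 x) := by
      have : Continuous fun t : ℝ => x + t • v := by fun_prop
      simpa using this.tendsto 0
    have c2 : Tendsto (fun t : ℝ => x + t • v + t • w) (𝓝 0) (𝓝 x) := by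
      have : Continuous fun t : ℝ => x + t • v + t • w := by fun_prop
      simpa using this.tendsto 0
    exact nhdsWithin_le_nhds ((c1.eventually hx).and (c2.eventually hx))
  have h2 : ∀ᶠ t : ℝ in 𝓝[>] 0, |e| ≤ t * C := by
    filter_upwards [h1, self_mem_nhdsWithin] with t ⟨ht1, ht2⟩ (ht0 : 0 < t)
    have hnorm : ∀ z : V, ‖t • z‖ = t * ‖z‖ := fun z => by
      rw [norm_smul, Real.norm_eq_abs, abs_of_pos ht0]
    have b1 := abs_taylor_le_of_tower hder hSD (h := t • (v + w))
      (fun y hy => hR y hy _ _) hS hxS (by rw [smul_add, ← add_assoc]; exact ht2)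
    have b2 := abs_taylor_le_of_tower hder hSD (h := t • v) (fun y hy => hR y hy _ _) hS hxS ht1
    have b3 := abs_taylor_le_of_tower hder hSD (h := t • w) (fun y hy => hR y hy _ _) hS ht1 ht2
    have b4 := abs_sub_le_of_tower hder hSD (h := t • v) (L := [w])
      (fun y hy => hR y hy _ _) hS hxS ht1
    rw [tower_smul hder hxD, hnorm] at b1 b2
    rw [tower_smul hder (hSD ht1), hnorm] at b3
    rw [hnorm] at b4
    rw [smul_add, ← add_assoc] at b1
    have b5 : |t * τ (x + t • v) [w] - t * τ x [w]| ≤ t * (R * (t * ‖v‖ * ‖w‖)) := by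
      rw [← mul_sub, abs_mul, abs_of_pos ht0]; gcongr
    have : |t * e| ≤ t * (t * C) := by
      rw [abs_le] at *
      constructor <;> simp only [he, hCdef] <;> nlinarith
    rw [abs_mul, abs_of_pos ht0] at this
    exact le_of_mul_le_mul_left this ht0
  have h3 : Tendsto (fun t : ℝ => t * C) (𝓝[>] 0) (𝓝 0) := by
    have : Continuous fun t : ℝ => t * C := by fun_prop
    simpa using (this.tendsto 0).mono_left nhdsWithin_le_nhds
  have h4 : |e| ≤ 0 := ge_of_tendsto h3 h2
  have := abs_nonpos_iff.1 h4
  linarith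

/-- A family of weighted functionals determining the norm of `Y`. -/
def IsNorming {Y ι : Type*} [NormedAddCommGroup Y] [NormedSpace ℝ Y] (Λ : ι → Y →L[ℝ] ℝ)
    (β : ι → ℝ) : Prop :=
  ∀ y r, 0 ≤ r → (∀ i, |Λ i y| ≤ r * β i) → ‖y‖ ≤ r

/-- Iterated directional derivatives of the functions `Λ i ∘ g`, along lists of vectors, which are
locally bounded uniformly in `i`. -/
structure IsTower {Y ι : Type*} [NormedAddCommGroup Y] [NormedSpace ℝ Y] (Λ : ι → Y →L[ℝ] ℝ)
    (β : ι → ℝ) (g : V → Y) (τ : ι → V → List V → ℝ) (D : Set V) : Prop where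
  nil : ∀ i, ∀ x ∈ D, τ i x [] = Λ i (g x)
  hasDerivAt : ∀ i, ∀ x ∈ D, ∀ h L,
    HasDerivAt (fun s : ℝ => τ i (x + s • h) L) (τ i x (h :: L)) 0
  bounded : ∀ k : ℕ, ∀ x₀ ∈ D, ∃ R : ℝ, ∀ᶠ x in 𝓝 x₀, ∀ i, ∀ L : List V, L.length = k →
    |τ i x L| ≤ R * β i * (L.map norm).prod

variable {Y ι : Type*} [NormedAddCommGroup Y] [NormedSpace ℝ Y] {Λ : ι → Y →L[ℝ] ℝ}
    {β : ι → ℝ} {g : V → Y} {τ : ι → V → List V → ℝ} {D : Set V}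

theorem IsNorming.eq {Λ : ι → Y →L[ℝ] ℝ} (hΛ : IsNorming Λ β) {y z : Y}
    (h : ∀ i, Λ i y = Λ i z) : y = z := by
  have := hΛ (y - z) 0 le_rfl fun i => by rw [map_sub, h i]; simp
  exact sub_eq_zero.1 (norm_le_zero_iff.1 this)

/-- The Taylor remainders are bounded by `R * β i * ‖h‖ ^ 2` uniformly in `i`, and a norming family
turns this into a bound in `Y`. So difference quotients are Cauchy, their limit is linear and
bounded, and the remainder is `O(‖h‖ ^ 2)`. -/
theorem IsTower.exists_hasFDerivAt [CompleteSpace Y] (hτ : IsTower Λ β g τ D)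
    (hβ : ∀ i, 0 ≤ β i) (hΛ : IsNorming Λ β) (hD : IsOpen D) {x : V} (hx : x ∈ D) :
    ∃ A : V →L[ℝ] Y, HasFDerivAt g A x ∧ ∀ i w, Λ i (A w) = τ i x [w] := by
  obtain ⟨R₁, hR₁⟩ := hτ.bounded 1 x hx
  obtain ⟨R₂', hR₂⟩ := hτ.bounded 2 x hx
  set R := max R₂' 0 with hRdef
  have hR0 : 0 ≤ R := le_max_right _ _
  obtain ⟨r, hr, hball⟩ := Metric.eventually_nhds_iff_ball.1 (hR₂.and (hD.mem_nhds hx))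
  set S := Metric.ball x r with hSdef
  have hS : Convex ℝ S := convex_ball x r
  have hSD : S ⊆ D := fun y hy => (hball y hy).2
  have hxS : x ∈ S := Metric.mem_ball_self hr
  have hS2 : ∀ i, ∀ y ∈ S, ∀ v w, |τ i y [v, w]| ≤ R * β i * (‖v‖ * ‖w‖) := by
    intro i y hy v w
    have := (hball y hy).1 i [v, w] rfl
    simp only [List.map_cons, List.map_nil, List.prod_cons, List.prod_nil, mul_one] at this
    refine this.trans ?_
    have := hβ i
    gcongr
    exact le_max_left _ _
  have taylor : ∀ i h, x + h ∈ S → |Λ i (g (x + h) - g x) - τ i x [h]| ≤ R * β i * (‖h‖ * ‖h‖) := by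
    intro i h hh
    have := abs_taylor_le_of_tower (hτ.hasDerivAt i) hSD (fun y hy => hS2 i y hy h h) hS hxS hh
    rwa [hτ.nil i _ (hSD hh), hτ.nil i _ hx, ← map_sub] at this
  have hex : ∀ h : V, ∃ y, ∀ i, Λ i y = τ i x [h] := by
    intro h
    obtain ⟨δ, hδ, hδS⟩ : ∃ δ : ℝ, 0 < δ ∧ ∀ s : ℝ, |s| ≤ δ → x + s • h ∈ S := by
      refine ⟨r / (2 * (‖h‖ + 1)), by positivity, fun s hs => ?_⟩
      rw [hSdef, mem_ball_iff_norm, add_sub_cancel_left, norm_smul, Real.norm_eq_abs]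
      calc |s| * ‖h‖ ≤ r / (2 * (‖h‖ + 1)) * (‖h‖ + 1) := by gcongr; linarith
        _ = r / 2 := by field_simp
        _ < r := by linarith
    set s : ℕ → ℝ := fun n => δ * (1 / ((n : ℝ) + 1)) with hs
    have hs0 : ∀ n, 0 < s n := fun n => by rw [hs]; positivity
    have hsδ : ∀ n, s n ≤ δ := fun n => by
      refine mul_le_of_le_one_right hδ.le ?_
      rw [div_le_one (by positivity)]; linarith [n.cast_nonneg (α := ℝ)]
    have hslim : Tendsto s atTop (𝓝 0) := by
      simpa [hs] using (tendsto_one_div_add_atTop_nhds_zero_nat (𝕜 := ℝ)).const_mul δ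
    have hsanti : ∀ n m, n ≤ m → s m ≤ s n := fun n m hnm => by
      simp only [hs]; gcongr
    set q : ℕ → Y := fun n => (s n)⁻¹ • (g (x + s n • h) - g x) with hq
    have hqb : ∀ n i, |Λ i (q n) - τ i x [h]| ≤ s n * (R * (‖h‖ * ‖h‖)) * β i := by
      intro n i
      have hsn := hs0 n
      have h1 := taylor i (s n • h) (hδS _ (by rw [abs_of_pos hsn]; exact hsδ n))
      rw [tower_smul (hτ.hasDerivAt i) hx, norm_smul, Real.norm_eq_abs, abs_of_pos hsn] at h1
      have h2 : Λ i (q n) - τ i x [h] =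
          (s n)⁻¹ * (Λ i (g (x + s n • h) - g x) - s n * τ i x [h]) := by
        rw [hq, map_smul, smul_eq_mul]; field_simp
      rw [h2, abs_mul, abs_inv, abs_of_pos hsn, inv_mul_le_iff₀ hsn]
      calc _ ≤ _ := h1
        _ = _ := by ring
    have hcau : CauchySeq q := by
      refine cauchySeq_of_le_tendsto_0 (fun N => 2 * (s N * (R * (‖h‖ * ‖h‖)))) ?_ ?_
      · intro n m N hn hm
        rw [dist_eq_norm]
        have hsN := hs0 N
        refine hΛ _ _ (by positivity) fun i => ?_
        have hb := hβ i
        have e1 := (hqb n i).trans (mul_le_mul_of_nonneg_right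
          (mul_le_mul_of_nonneg_right (hsanti N n hn) (by positivity)) hb)
        have e2 := (hqb m i).trans (mul_le_mul_of_nonneg_right
          (mul_le_mul_of_nonneg_right (hsanti N m hm) (by positivity)) hb)
        rw [map_sub]
        rw [abs_le] at *
        constructor <;> linarith
      · have := (hslim.mul_const (R * (‖h‖ * ‖h‖))).const_mul 2
        simpa using this
    obtain ⟨y, hy⟩ := cauchySeq_tendsto_of_complete hcau
    refine ⟨y, fun i => ?_⟩
    have t1 : Tendsto (fun n => Λ i (q n)) atTop (𝓝 (Λ i y)) :=
      ((Λ i).continuous.tendsto y).comp hy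
    refine tendsto_nhds_unique t1 ?_
    rw [tendsto_iff_dist_tendsto_zero]
    refine squeeze_zero (fun _ => dist_nonneg) (fun n => ?_)
      (by simpa using (hslim.mul_const (R * (‖h‖ * ‖h‖))).mul_const (β i))
    rw [Real.dist_eq]
    exact hqb n i
  choose A hA using hex
  have hadd : ∀ v w, A (v + w) = A v + A w := fun v w => hΛ.eq fun i => by
    rw [map_add, hA, hA, hA]
    exact tower_add (hτ.hasDerivAt i) hSD (hS2 i) hS (Metric.ball_mem_nhds x hr) v w
  have hsmul : ∀ (a : ℝ) v, A (a • v) = a • A v := fun a v => hΛ.eq fun i => by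
    rw [map_smul, hA, hA, tower_smul (hτ.hasDerivAt i) hx, smul_eq_mul]
  have hbound : ∀ v, ‖A v‖ ≤ max R₁ 0 * ‖v‖ := fun v => by
    refine hΛ _ _ (by positivity) fun i => ?_
    rw [hA]
    have := hR₁.self_of_nhds i [v] rfl
    simp only [List.map_cons, List.map_nil, List.prod_cons, List.prod_nil, mul_one] at this
    have hb := hβ i
    calc _ ≤ R₁ * β i * ‖v‖ := this
      _ ≤ max R₁ 0 * β i * ‖v‖ := by gcongr; exact le_max_left _ _
      _ = _ := by ring
  refine ⟨LinearMap.mkContinuous ⟨⟨A, hadd⟩, hsmul⟩ _ hbound, ?_, fun i w => hA w i⟩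
  rw [hasFDerivAt_iff_isLittleO_nhds_zero]
  have hO : (fun h : V => g (x + h) - g x - A h) =O[𝓝 0] fun h : V => ‖h‖ ^ 2 := by
    refine Asymptotics.IsBigO.of_bound R ?_
    have : ∀ᶠ h : V in 𝓝 0, x + h ∈ S := by
      have c : Continuous fun h : V => x + h := by fun_prop
      exact (c.tendsto 0).eventually (by simpa using Metric.ball_mem_nhds x hr)
    filter_upwards [this] with h hh
    rw [norm_pow, norm_norm]
    refine hΛ _ _ (by positivity) fun i => ?_
    rw [map_sub, hA]
    calc _ ≤ _ := taylor i h hh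
      _ = _ := by ring
  exact hO.trans_isLittleO (Asymptotics.isLittleO_norm_pow_id one_lt_two)

end Tower

/-- The derivative of `g` again has a tower, with the norming family `A ↦ Λ i (A w)`, `‖w‖ ≤ 1`. The
induction replaces `Y` by `V →L[ℝ] Y`, so the universe of `Y` has to absorb that of `V`. -/
theorem IsTower.contDiffOn_nat {V : Type u} [NormedAddCommGroup V] [NormedSpace ℝ V] {D : Set V}
    (hD : IsOpen D) (n : ℕ) : ∀ {Y : Type (max u v)} [NormedAddCommGroup Y] [NormedSpace ℝ Y]
    [CompleteSpace Y] {ι : Type (max u v)} {Λ : ι → Y →L[ℝ] ℝ} {β : ι → ℝ} {g : V → Y}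
    {τ : ι → V → List V → ℝ}, IsTower Λ β g τ D → (∀ i, 0 ≤ β i) → IsNorming Λ β →
    ContDiffOn ℝ n g D := by
  induction n with
  | zero =>
    intro Y _ _ _ ι Λ β g τ hτ hβ hΛ
    rw [Nat.cast_zero, contDiffOn_zero]
    intro x hx
    obtain ⟨A, hA, -⟩ := hτ.exists_hasFDerivAt hβ hΛ hD hx
    exact hA.continuousAt.continuousWithinAt
  | succ n ih =>
    intro Y _ _ _ ι Λ β g τ hτ hβ hΛ
    have key : ∀ x ∈ D, HasFDerivAt g (fderiv ℝ g x) x ∧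
        ∀ i w, Λ i (fderiv ℝ g x w) = τ i x [w] := by
      intro x hx
      obtain ⟨A, hA, hA'⟩ := hτ.exists_hasFDerivAt hβ hΛ hD hx
      rw [hA.fderiv]
      exact ⟨hA, hA'⟩
    rw [Nat.cast_succ, contDiffOn_succ_iff_fderiv_of_isOpen hD]
    refine ⟨fun x hx => (key x hx).1.differentiableAt.differentiableWithinAt, by simp, ?_⟩
    let Λ' : ι × Metric.closedBall (0 : V) 1 → (V →L[ℝ] Y) →L[ℝ] ℝ := fun j =>
      (Λ j.1).comp (ContinuousLinearMap.apply ℝ Y j.2.1)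
    -- The head of a list is the direction differentiated last, so the direction of the first
    -- derivative is appended at the end.
    refine ih (Λ := Λ') (β := fun j => β j.1) (τ := fun j x L => τ j.1 x (L ++ [j.2.1]))
      ⟨?_, ?_, ?_⟩ (fun j => hβ _) ?_
    · intro j x hx
      exact ((key x hx).2 j.1 j.2).symm
    · intro j x hx h L
      exact hτ.hasDerivAt j.1 x hx h (L ++ [j.2.1])
    · intro k x₀ hx₀
      obtain ⟨R, hR⟩ := hτ.bounded (k + 1) x₀ hx₀
      refine ⟨max R 0, ?_⟩
      filter_upwards [hR] with x hx j L hL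
      have hb := hβ j.1
      have hp : 0 ≤ (L.map norm).prod := List.prod_nonneg (by simp)
      have hj : ‖(j.2.1 : V)‖ ≤ 1 := mem_closedBall_zero_iff.1 j.2.2
      refine (hx j.1 (L ++ [j.2.1]) (by simp [hL])).trans ?_
      rw [List.map_append, List.prod_append]
      simp only [List.map_cons, List.map_nil, List.prod_cons, List.prod_nil, mul_one]
      calc R * β j.1 * ((L.map norm).prod * ‖j.2.1‖)
          ≤ max R 0 * β j.1 * ((L.map norm).prod * ‖j.2.1‖) := by gcongr; exact le_max_left _ _
        _ ≤ max R 0 * β j.1 * ((L.map norm).prod * 1) := by gcongr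
        _ = _ := by ring
    · intro A r hr hA
      refine ContinuousLinearMap.opNorm_le_of_unit_norm hr fun w hw => ?_
      exact hΛ _ _ hr fun i => hA (i, ⟨w, by simp [hw]⟩)

theorem IsTower.contDiffOn {V : Type u} {Y : Type v} {ι : Type w}
    [NormedAddCommGroup V] [NormedSpace ℝ V]
    [NormedAddCommGroup Y] [NormedSpace ℝ Y] [CompleteSpace Y] {D : Set V} (hD : IsOpen D)
    {Λ : ι → Y →L[ℝ] ℝ} {β : ι → ℝ} {g : V → Y} {τ : ι → V → List V → ℝ}
    (hτ : IsTower Λ β g τ D) (hβ : ∀ i, 0 ≤ β i) (hΛ : IsNorming Λ β) :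
    ContDiffOn ℝ ∞ g D := by
  rw [contDiffOn_infty]
  intro n
  -- Lifting to a common universe meets the restrictions of the induction.
  let e : ULift.{max u w} Y ≃ₗᵢ[ℝ] Y := LinearIsometryEquiv.ulift ℝ Y
  have : ContDiffOn ℝ n (fun x => e.symm (g x)) D := by
    refine IsTower.contDiffOn_nat.{u, max v w} (Y := ULift.{max u w} Y) (ι := ULift.{max u v} ι)
      hD n
      (Λ := fun i => (Λ i.down).comp (e.toContinuousLinearEquiv : ULift.{max u w} Y →L[ℝ] Y))
      (β := fun i => β i.down)
      (τ := fun i => τ i.down) ⟨fun i => hτ.nil i.down, fun i => hτ.hasDerivAt i.down, ?_⟩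
      (fun i => hβ _) ?_
    · intro k x₀ hx₀
      obtain ⟨R, hR⟩ := hτ.bounded k x₀ hx₀
      exact ⟨R, hR.mono fun x hx i => hx i.down⟩
    · intro y r hr hy
      rw [← e.norm_map]
      exact hΛ _ _ hr fun i => hy ⟨i⟩
  exact e.contDiff.comp_contDiffOn this

/-! ### Weakly bounded sets are bounded -/

section Mackey

variable {E : Type*} [AddCommGroup E] [Module ℝ E]

/-- The space `E`, seminormed by `p`. -/
def SeminormedCopy (_p : Seminorm ℝ E) : Type _ := E

instance (p : Seminorm ℝ E) : SeminormedAddCommGroup (SeminormedCopy p) :=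
  AddGroupSeminorm.toSeminormedAddCommGroup (E := E) p.toAddGroupSeminorm

instance (p : Seminorm ℝ E) : Module ℝ (SeminormedCopy p) := inferInstanceAs (Module ℝ E)

instance (p : Seminorm ℝ E) : NormedSpace ℝ (SeminormedCopy p) where
  norm_smul_le a x := (map_smul_eq_mul p a x).le

variable [TopologicalSpace E] [IsTopologicalAddGroup E]

/-- Points of `S` act on the dual of `(E, p)`, a Banach space, and are pointwise bounded there.
Banach–Steinhaus bounds their norms in the bidual, and Hahn–Banach recovers `p x` from these. -/
theorem exists_seminorm_le_of_weakly_bounded {p : Seminorm ℝ E}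
    (hp : Continuous p) {S : Set E} (h : ∀ ℓ : E →L[ℝ] ℝ, ∃ C, ∀ x ∈ S, |ℓ x| ≤ C) :
    ∃ C, ∀ x ∈ S, p x ≤ C := by
  let J : S → StrongDual ℝ (StrongDual ℝ (SeminormedCopy p)) := fun x =>
    NormedSpace.inclusionInDoubleDual ℝ (SeminormedCopy p) x.1
  obtain ⟨C, hC⟩ := banach_steinhaus (g := J) fun φ => by
    let ℓ : E →ₗ[ℝ] ℝ := φ.toLinearMap
    have hℓ : ∀ x, |ℓ x| ≤ ‖φ‖ * p x := fun x => φ.le_opNorm x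
    have hc : Continuous ℓ := by
      refine continuous_of_continuousAt_zero ℓ ?_
      rw [ContinuousAt, map_zero]
      refine squeeze_zero_norm hℓ ?_
      have := (hp.tendsto 0).const_mul ‖φ‖
      simpa using this
    obtain ⟨C, hC⟩ := h ⟨ℓ, hc⟩
    exact ⟨C, fun x => hC x.1 x.2⟩
  refine ⟨C, fun x hx => ?_⟩
  obtain ⟨φ, hφ, hφx⟩ := exists_dual_vector'' ℝ (E := SeminormedCopy p) x
  have h1 : ‖J ⟨x, hx⟩ φ‖ ≤ C * 1 :=
    (J ⟨x, hx⟩).le_of_opNorm_le_of_le (hC ⟨x, hx⟩) hφ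
  have h2 : J ⟨x, hx⟩ φ = p x := hφx
  rw [h2, mul_one] at h1
  exact (le_abs_self _).trans h1

/-- **Mackey's theorem**: weakly bounded sets are bounded. -/
theorem isVonNBounded_of_weakly_bounded [ContinuousSMul ℝ E] [LocallyConvexSpace ℝ E] {S : Set E}
    (h : ∀ ℓ : E →L[ℝ] ℝ, ∃ C, ∀ x ∈ S, |ℓ x| ≤ C) : Bornology.IsVonNBounded ℝ S := by
  have hw := with_gaugeSeminormFamily (𝕜 := ℝ) (E := E)
  rw [hw.isVonNBounded_iff_seminorm_bddAbove]
  intro i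
  obtain ⟨C, hC⟩ := exists_seminorm_le_of_weakly_bounded (hw.continuous_seminorm i) h
  exact ⟨C, forall_mem_image.2 hC⟩

end Mackey

/-! ### Banach spaces spanned by disks given by bounds on functionals -/

section Disks

set_option linter.unusedSectionVars false

variable {E : Type*} [AddCommGroup E] [Module ℝ E] [TopologicalSpace E]
  [IsTopologicalAddGroup E] [ContinuousSMul ℝ E] [T2Space E]

namespace Disk

theorem norm_def (B : Disk E) (x : B.Space) : ‖x‖ = gauge B.unitSet x := rfl

theorem norm_le_of_incl_mem_smul (B : Disk E) {x : B.Space} {r : ℝ} (hr : 0 ≤ r)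
    {y : E} (hy : y ∈ B.carrier) (hxy : B.incl x = r • y) : ‖x‖ ≤ r := by
  rw [norm_def]
  refine gauge_le_of_mem hr ⟨⟨y, Submodule.subset_span hy⟩, hy, Subtype.ext hxy.symm⟩

theorem exists_incl_eq_smul (B : Disk E) {x : B.Space} {r : ℝ} (hr : ‖x‖ < r) :
    ∃ y ∈ B.carrier, B.incl x = r • y := by
  obtain ⟨s, hs, hsr, y, hy, rfl⟩ := exists_lt_of_gauge_lt B.absorbent_unitSet hr
  refine ⟨(r⁻¹ * s) • y.1, B.absConvex.1 (r⁻¹ * s) ?_ ⟨y.1, hy, rfl⟩, ?_⟩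
  · have : 0 < r := hs.trans hsr
    rw [Real.norm_eq_abs, abs_of_pos (by positivity), inv_mul_le_iff₀ this]
    linarith
  · rw [smul_smul, mul_inv_cancel_left₀ (hs.trans hsr).ne']
    rfl

theorem continuous_incl (B : Disk E) : Continuous B.incl := by
  have himg : Bornology.IsVonNBounded ℝ (B.incl '' Metric.ball 0 1) := by
    refine B.bounded.subset ?_
    rintro _ ⟨x, hx, rfl⟩
    obtain ⟨y, hy, hxy⟩ := B.exists_incl_eq_smul (x := x) (r := 1) (by simpa using hx)
    rwa [hxy, one_smul]
  exact (B.incl.clmOfExistsBoundedImage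
    ⟨Metric.ball 0 1, Metric.ball_mem_nhds 0 one_pos, himg⟩).continuous

/-- The inclusion `E_B → E` as a continuous linear map. -/
def inclL (B : Disk E) : B.Space →L[ℝ] E := ⟨B.incl, B.continuous_incl⟩

theorem incl_injective (B : Disk E) : Function.Injective B.incl := Subtype.val_injective

end Disk

variable [LocallyConvexSpace ℝ E]

/-- The absolutely convex set of those `y` with `|ℓ y| ≤ b ℓ` for all functionals `ℓ`. -/
def weakDisk (b : (E →L[ℝ] ℝ) → ℝ) (hb : ∀ ℓ, 0 ≤ b ℓ) : Disk E where
  carrier := {y | ∀ ℓ : E →L[ℝ] ℝ, |ℓ y| ≤ b ℓ}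
  nonempty := ⟨0, fun ℓ => by simpa using hb ℓ⟩
  isClosed := by
    simp only [ofPred_forall]
    exact isClosed_iInter fun ℓ => isClosed_le ℓ.continuous.abs continuous_const
  absConvex := by
    constructor
    · rintro a ha _ ⟨y, hy, rfl⟩ ℓ
      rw [map_smul, smul_eq_mul, abs_mul]
      exact (mul_le_of_le_one_left (abs_nonneg _) ha).trans (hy ℓ)
    · intro x hx y hy s t hs ht hst ℓ
      rw [map_add, map_smul, map_smul, smul_eq_mul, smul_eq_mul]
      calc |s * ℓ x + t * ℓ y| ≤ s * |ℓ x| + t * |ℓ y| := by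
            refine (abs_add_le _ _).trans_eq ?_
            rw [abs_mul, abs_mul, abs_of_nonneg hs, abs_of_nonneg ht]
        _ ≤ s * b ℓ + t * b ℓ := by
            have h1 := hx ℓ
            have h2 := hy ℓ
            gcongr
        _ = b ℓ := by rw [← add_mul, hst, one_mul]
  bounded := isVonNBounded_of_weakly_bounded fun ℓ => ⟨b ℓ, fun _ hy => hy ℓ⟩

variable {b b' : (E →L[ℝ] ℝ) → ℝ} {hb : ∀ ℓ, 0 ≤ b ℓ} {hb' : ∀ ℓ, 0 ≤ b' ℓ}

theorem exists_weakDisk_incl_eq {y : E} {r : ℝ} (hy : ∀ ℓ : E →L[ℝ] ℝ, |ℓ y| ≤ r * b ℓ) :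
    ∃ x : (weakDisk b hb).Space, (weakDisk b hb).incl x = y := by
  -- The maximum with `1` allows `r` to be zero or negative.
  have hm : (max r 1)⁻¹ • y ∈ (weakDisk b hb).carrier := fun ℓ => by
    have h0 := hb ℓ
    have h1 : 0 < max r 1 := lt_max_of_lt_right one_pos
    rw [map_smul, smul_eq_mul, abs_mul, abs_inv, abs_of_pos h1, inv_mul_le_iff₀ h1]
    exact (hy ℓ).trans (by gcongr; exact le_max_left _ _)
  have h2 : y ∈ Submodule.span ℝ (weakDisk b hb).carrier := by
    have := Submodule.smul_mem _ (max r 1) (Submodule.subset_span hm)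
    rwa [smul_inv_smul₀ (lt_max_of_lt_right one_pos).ne'] at this
  exact ⟨⟨y, h2⟩, rfl⟩

theorem norm_weakDisk_le {x : (weakDisk b hb).Space} {r : ℝ} (hr : 0 ≤ r)
    (hx : ∀ ℓ : E →L[ℝ] ℝ, |ℓ ((weakDisk b hb).incl x)| ≤ r * b ℓ) : ‖x‖ ≤ r := by
  refine le_of_forall_gt_imp_ge_of_dense fun s hs => ?_
  have hs0 := hr.trans_lt hs
  refine (weakDisk b hb).norm_le_of_incl_mem_smul hs0.le (y := s⁻¹ • (weakDisk b hb).incl x)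
    (fun ℓ => ?_) (smul_inv_smul₀ hs0.ne' _).symm
  have := hb ℓ
  rw [map_smul, smul_eq_mul, abs_mul, abs_inv, abs_of_pos hs0, inv_mul_le_iff₀ hs0]
  exact (hx ℓ).trans (by gcongr)

theorem abs_apply_incl_le (x : (weakDisk b hb).Space) (ℓ : E →L[ℝ] ℝ) :
    |ℓ ((weakDisk b hb).incl x)| ≤ ‖x‖ * b ℓ := by
  have key : ∀ s, ‖x‖ < s → |ℓ ((weakDisk b hb).incl x)| ≤ s * b ℓ := by
    intro s hs
    obtain ⟨y, hy, hxy⟩ := (weakDisk b hb).exists_incl_eq_smul hs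
    have hs0 := (norm_nonneg x).trans_lt hs
    rw [hxy, map_smul, smul_eq_mul, abs_mul, abs_of_pos hs0]
    exact mul_le_mul_of_nonneg_left (hy ℓ) hs0.le
  have hlim : Tendsto (fun s => s * b ℓ) (𝓝[>] ‖x‖) (𝓝 (‖x‖ * b ℓ)) := by
    have : Continuous fun s : ℝ => s * b ℓ := by fun_prop
    exact (this.tendsto _).mono_left nhdsWithin_le_nhds
  exact ge_of_tendsto hlim (eventually_nhdsWithin_of_forall key)

theorem isNorming_weakDisk : IsNorming
    (fun ℓ : E →L[ℝ] ℝ => ℓ.comp (weakDisk b hb).inclL) b :=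
  fun _ _ hr h => norm_weakDisk_le hr h

/-- The inclusion of the Banach spaces of comparable weak disks. -/
theorem exists_weakDisk_inclusion (h : ∀ ℓ, b ℓ ≤ b' ℓ) :
    ∃ j : (weakDisk b hb).Space →L[ℝ] (weakDisk b' hb').Space,
      ∀ x, (weakDisk b' hb').incl (j x) = (weakDisk b hb).incl x := by
  have hle : ∀ (x : (weakDisk b hb).Space) (ℓ : E →L[ℝ] ℝ),
      |ℓ ((weakDisk b hb).incl x)| ≤ ‖x‖ * b' ℓ := fun x ℓ =>
    (abs_apply_incl_le x ℓ).trans (by gcongr; exact h ℓ)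
  choose j hj using fun x => exists_weakDisk_incl_eq (hb := hb') (hle x)
  have hinj := (weakDisk b' hb').incl_injective
  let jl : (weakDisk b hb).Space →ₗ[ℝ] (weakDisk b' hb').Space :=
    { toFun := j
      map_add' := fun x y => hinj (by rw [map_add, hj, hj, hj, map_add])
      map_smul' := fun a x => hinj (by rw [map_smul, hj, hj, map_smul]; rfl) }
  exact ⟨jl.mkContinuous 1 fun x => by
    rw [one_mul]
    exact norm_weakDisk_le (norm_nonneg x) fun ℓ => by
      change |ℓ ((weakDisk b' hb').incl (j x))| ≤ _
      rw [hj]; exact hle x ℓ, hj⟩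

end Disks

/-! ### Iterated directional derivatives -/

section Directional

variable {V W : Type*} [NormedAddCommGroup V] [NormedSpace ℝ V]
  [NormedAddCommGroup W] [NormedSpace ℝ W]

/-- The iterated directional derivative of `φ` along a list of vectors. -/
noncomputable def iteratedDir (φ : V → ℝ) : List V → V → ℝ
  | [], x => φ x
  | h :: L, x => deriv (fun s : ℝ => iteratedDir φ L (x + s • h)) 0

/-- An identity of one-variable derivatives that needs no differentiability; it reduces questions on
`V` to finite-dimensional subspaces. -/
theorem iteratedDir_map (φ : V → ℝ) (P : W →ₗ[ℝ] V) (x : V) (L : List W) (t : W) :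
    iteratedDir φ (L.map P) (x + P t) = iteratedDir (fun t => φ (x + P t)) L t := by
  induction L generalizing t with
  | nil => rfl
  | cons h L ih =>
    simp only [List.map_cons, iteratedDir, ← ih]
    congr 1
    ext s
    rw [map_add, map_smul, add_assoc]

theorem eventually_add_smul_mem {D : Set V} (hD : IsOpen D) {x : V} (hx : x ∈ D) (h : V) :
    ∀ᶠ s : ℝ in 𝓝 0, x + s • h ∈ D := by
  have : Continuous fun s : ℝ => x + s • h := by fun_prop
  exact (this.tendsto 0).eventually (by simpa using hD.mem_nhds hx)

theorem iteratedDir_congr {φ ψ : V → ℝ} {D : Set V} (hD : IsOpen D) (h : ∀ x ∈ D, φ x = ψ x)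
    (L : List V) : ∀ x ∈ D, iteratedDir φ L x = iteratedDir ψ L x := by
  induction L with
  | nil => exact h
  | cons v L ih =>
    intro x hx
    refine Filter.EventuallyEq.deriv_eq ?_
    filter_upwards [eventually_add_smul_mem hD hx v] with s hs using ih _ hs

theorem hasDerivAt_iteratedFDerivWithin {φ : V → ℝ} {D : Set V} (hD : IsOpen D)
    (hφ : ContDiffOn ℝ ∞ φ D) {x : V} (hx : x ∈ D) (h : V) (L : List V) :
    HasDerivAt (fun s : ℝ => iteratedFDerivWithin ℝ L.length φ D (x + s • h) L.get)
      (iteratedFDerivWithin ℝ (h :: L).length φ D x (h :: L).get) 0 := by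
  have h1 : DifferentiableAt ℝ (iteratedFDerivWithin ℝ L.length φ D) x :=
    ((hφ.differentiableOn_iteratedFDerivWithin (by exact_mod_cast ENat.natCast_lt_top _)
      hD.uniqueDiffOn) x hx).differentiableAt (hD.mem_nhds hx)
  have h2 : HasFDerivAt (fun y => iteratedFDerivWithin ℝ L.length φ D y L.get)
      ((ContinuousMultilinearMap.apply ℝ (fun _ : Fin L.length => V) ℝ L.get).comp
        (fderiv ℝ (iteratedFDerivWithin ℝ L.length φ D) x)) x :=
    (ContinuousMultilinearMap.apply ℝ (fun _ : Fin L.length => V) ℝ L.get).hasFDerivAt.comp x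
      h1.hasFDerivAt
  have h3 : HasDerivAt (fun s : ℝ => x + s • h) h 0 := by
    simpa using ((hasDerivAt_id (0 : ℝ)).smul_const h).const_add x
  have h4 := HasFDerivAt.comp_hasDerivAt (0 : ℝ) (by simpa using h2) h3
  refine HasDerivAt.congr_deriv h4 ?_
  have h5 : iteratedFDerivWithin ℝ (L.length + 1) φ D x (h :: L).get = _ :=
    iteratedFDerivWithin_succ_apply_left (𝕜 := ℝ) (f := φ) (s := D) (x := x) (h :: L).get
  rw [fderivWithin_of_isOpen hD hx] at h5
  exact h5.symm

theorem iteratedDir_eq {φ : V → ℝ} {D : Set V} (hD : IsOpen D) (hφ : ContDiffOn ℝ ∞ φ D)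
    (L : List V) : ∀ x ∈ D, iteratedDir φ L x = iteratedFDerivWithin ℝ L.length φ D x L.get := by
  induction L with
  | nil => intro x _; simp [iteratedDir]
  | cons v L ih =>
    intro x hx
    rw [← (hasDerivAt_iteratedFDerivWithin hD hφ hx v L).deriv]
    refine Filter.EventuallyEq.deriv_eq ?_
    filter_upwards [eventually_add_smul_mem hD hx v] with s hs using ih _ hs

theorem hasDerivAt_iteratedDir {φ : V → ℝ} {D : Set V} (hD : IsOpen D) (hφ : ContDiffOn ℝ ∞ φ D)
    {x : V} (hx : x ∈ D) (h : V) (L : List V) :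
    HasDerivAt (fun s : ℝ => iteratedDir φ L (x + s • h)) (iteratedDir φ (h :: L) x) 0 := by
  rw [iteratedDir_eq hD hφ _ x hx]
  refine (hasDerivAt_iteratedFDerivWithin hD hφ hx h L).congr_of_eventuallyEq ?_
  filter_upwards [eventually_add_smul_mem hD hx h] with s hs using iteratedDir_eq hD hφ _ _ hs

theorem abs_iteratedDir_le {φ : V → ℝ} {D : Set V} (hD : IsOpen D) (hφ : ContDiffOn ℝ ∞ φ D)
    {x : V} (hx : x ∈ D) (L : List V) :
    |iteratedDir φ L x| ≤ ‖iteratedFDerivWithin ℝ L.length φ D x‖ * (L.map norm).prod := by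
  rw [iteratedDir_eq hD hφ _ x hx]
  have h1 : ∏ i, ‖L.get i‖ = (L.map norm).prod := by
    rw [← List.prod_ofFn, ← Function.comp_def norm L.get, ← List.map_ofFn, List.ofFn_get]
  rw [← h1]
  exact (iteratedFDerivWithin ℝ L.length φ D x).le_opNorm L.get

theorem prod_map_norm_map_le (P : W →L[ℝ] V) (L : List W) :
    ((L.map P).map norm).prod ≤ ‖P‖ ^ L.length * (L.map norm).prod := by
  induction L with
  | nil => simp
  | cons h L ih =>
    simp only [List.map_cons, List.prod_cons, List.length_cons]
    have : 0 ≤ ((L.map P).map norm).prod := List.prod_nonneg (by simp)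
    calc _ ≤ (‖P‖ * ‖h‖) * (‖P‖ ^ L.length * (L.map norm).prod) := by
          gcongr; exact P.le_opNorm h
      _ = _ := by ring

/-- Every list of vectors is the image of a list in a finite-dimensional space. -/
theorem exists_map_eq (L : List V) : ∃ (n : ℕ) (P : (Fin n → ℝ) →L[ℝ] V)
    (L' : List (Fin n → ℝ)), L'.map P = L := by
  refine ⟨L.length, LinearMap.toContinuousLinearMap (Fintype.linearCombination ℝ L.get),
    List.ofFn fun i => Pi.single i 1, ?_⟩
  rw [List.map_ofFn]
  conv_rhs => rw [← List.ofFn_get L]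
  congr 1
  ext i
  simp

end Directional

/-! ### Lifting weakly smooth maps to a Banach space -/

section Lift

variable {E : Type*} [AddCommGroup E] [Module ℝ E] [TopologicalSpace E]
  [IsTopologicalAddGroup E] [ContinuousSMul ℝ E] [T2Space E] [LocallyConvexSpace ℝ E]
  {W : Type*} [NormedAddCommGroup W] [NormedSpace ℝ W]

/-- A weakly smooth map, with derivatives bounded in the weak disk given by `b`, is smooth into the
Banach space spanned by this disk. -/
theorem exists_smooth_lift {b : (E →L[ℝ] ℝ) → ℝ} (hb : ∀ ℓ, 0 ≤ b ℓ)
    [CompleteSpace (weakDisk b hb).Space] {Ω : Set W} (hΩ : IsOpen Ω) {c : W → E}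
    (hc : ∀ ℓ : E →L[ℝ] ℝ, ContDiffOn ℝ ∞ (fun t => ℓ (c t)) Ω) (R : ℕ → ℝ)
    (hR : ∀ ℓ : E →L[ℝ] ℝ, ∀ t ∈ Ω, ∀ L : List W,
      |iteratedDir (fun t => ℓ (c t)) L t| ≤ R L.length * b ℓ * (L.map norm).prod) :
    ∃ γ : W → (weakDisk b hb).Space, ContDiffOn ℝ ∞ γ Ω ∧
      ∀ t ∈ Ω, (weakDisk b hb).incl (γ t) = c t := by
  have hex : ∀ t, ∃ y : (weakDisk b hb).Space, t ∈ Ω → (weakDisk b hb).incl y = c t := by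
    intro t
    by_cases ht : t ∈ Ω
    · obtain ⟨y, hy⟩ := exists_weakDisk_incl_eq (hb := hb) (y := c t) (r := R 0) fun ℓ => by
        simpa [iteratedDir] using hR ℓ t ht []
      exact ⟨y, fun _ => hy⟩
    · exact ⟨0, fun h => absurd h ht⟩
  choose γ hγ using hex
  refine ⟨γ, ?_, hγ⟩
  refine IsTower.contDiffOn hΩ (Λ := fun ℓ : E →L[ℝ] ℝ => ℓ.comp (weakDisk b hb).inclL) (β := b)
    (τ := fun ℓ t L => iteratedDir (fun t => ℓ (c t)) L t) ⟨?_, ?_, ?_⟩ hb isNorming_weakDisk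
  · intro ℓ t ht
    change ℓ (c t) = ℓ ((weakDisk b hb).incl (γ t))
    rw [hγ t ht]
  · intro ℓ t ht h L
    exact hasDerivAt_iteratedDir hΩ (hc ℓ) ht h L
  · intro k t₀ ht₀
    refine ⟨R k, ?_⟩
    filter_upwards [hΩ.mem_nhds ht₀] with t ht ℓ L hL
    rw [← hL]
    exact hR ℓ t ht L

end Lift

/-! ### Smooth curves through fast sequences; traces of `c^∞`-open sets -/

section SpecialCurve

variable {Y : Type*} [NormedAddCommGroup Y] [NormedSpace ℝ Y]

theorem bump_two_pow_mul_inv (φ : ContDiffBump (1 : ℝ)) (hφ : φ.rOut = 1 / 4) (n m : ℕ) :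
    φ ((2 : ℝ) ^ n * (2 ^ m)⁻¹) = if n = m then 1 else 0 := by
  split_ifs with h
  · subst h
    rw [mul_inv_cancel₀ (by positivity)]
    exact φ.one_of_mem_closedBall (Metric.mem_closedBall_self φ.rIn_pos.le)
  · refine φ.zero_of_le_dist ?_
    rw [hφ, Real.dist_eq]
    rcases lt_or_gt_of_ne h with h | h
    · have h1 : (2 : ℝ) ^ n * (2 ^ m)⁻¹ ≤ 1 / 2 := by
        rw [← div_eq_mul_inv, div_le_iff₀ (by positivity)]
        have : (2 : ℝ) ^ (n + 1) ≤ 2 ^ m := pow_le_pow_right₀ (by norm_num) h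
        rw [pow_succ] at this
        linarith
      rw [abs_sub_comm]
      exact le_trans (by linarith) (le_abs_self _)
    · have h1 : 2 ≤ (2 : ℝ) ^ n * (2 ^ m)⁻¹ := by
        rw [← div_eq_mul_inv, le_div_iff₀ (by positivity)]
        have : (2 : ℝ) ^ (m + 1) ≤ 2 ^ n := pow_le_pow_right₀ (by norm_num) h
        rw [pow_succ] at this
        linarith
      exact le_trans (by linarith) (le_abs_self _)

/-- Through every rapidly convergent sequence there is a smooth curve. -/
theorem exists_smooth_curve_through [CompleteSpace Y] {z : ℕ → Y}
    (hz : ∀ n, ‖z n‖ ≤ ((2 : ℝ) ^ n)⁻¹ ^ (n + 1)) :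
    ∃ γ : ℝ → Y, ContDiff ℝ ∞ γ ∧ γ 0 = 0 ∧ ∀ n, γ ((2 ^ n)⁻¹) = z n := by
  -- The curve is `∑ φ(2 ^ n t) z n`. The bump lives so close to `1` that at `t = 2⁻ᵐ` only the term
  -- `n = m` survives; `k` derivatives cost `2 ^ (n * k)`, which the decay of `z n` outweighs once
  -- `n ≥ k`.
  let φ : ContDiffBump (1 : ℝ) := ⟨1 / 8, 1 / 4, by norm_num, by norm_num⟩
  have hφs : ContDiff ℝ ∞ φ := φ.contDiff
  have hbd : ∀ k : ℕ, ∃ C, ∀ t, ‖iteratedFDeriv ℝ k φ t‖ ≤ C := fun k =>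
    (φ.hasCompactSupport.iteratedFDeriv k).exists_bound_of_continuous
      (hφs.continuous_iteratedFDeriv (by exact_mod_cast le_top))
  choose C hC using hbd
  have hC0 : ∀ k, 0 ≤ C k := fun k => (norm_nonneg _).trans (hC k 0)
  let A : ℕ → ℝ →L[ℝ] ℝ := fun n => (2 : ℝ) ^ n • ContinuousLinearMap.id ℝ ℝ
  have hA : ∀ n, ‖A n‖ ≤ 2 ^ n := fun n => by
    simp only [A]
    rw [norm_smul, ContinuousLinearMap.norm_id, mul_one, norm_pow, Real.norm_ofNat]
  let F : ℕ → ℝ → Y := fun n t => (φ ∘ A n) t • z n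
  have hcomp : ∀ n, ContDiff ℝ ∞ (φ ∘ A n) := fun n => hφs.comp (A n).contDiff
  have hF : ∀ n, ContDiff ℝ ∞ (F n) := fun n => (hcomp n).smul contDiff_const
  have hFb : ∀ (k n : ℕ) (t : ℝ), (k : ℕ∞) ≤ (⊤ : ℕ∞) → ‖iteratedFDeriv ℝ k (F n) t‖ ≤
      C k * ((2 ^ n) ^ k * ((2 : ℝ) ^ n)⁻¹ ^ (n + 1)) := by
    intro k n t _
    have e1 : F n = (ContinuousLinearMap.smulRight (1 : ℝ →L[ℝ] ℝ) (z n)) ∘ (φ ∘ A n) := by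
      ext t; simp [F]
    rw [e1, ContinuousLinearMap.iteratedFDeriv_comp_left _ (hcomp n).contDiffAt
      (i := k) (by exact_mod_cast le_top),
      ContinuousLinearMap.iteratedFDeriv_comp_right (A n) hφs t (by exact_mod_cast le_top)]
    refine (ContinuousLinearMap.norm_compContinuousMultilinearMap_le _ _).trans ?_
    have e2 : ‖ContinuousLinearMap.smulRight (1 : ℝ →L[ℝ] ℝ) (z n)‖ ≤
        ((2 : ℝ) ^ n)⁻¹ ^ (n + 1) := by
      rw [ContinuousLinearMap.norm_smulRight_apply]
      simpa using hz n
    have e3 : ‖(iteratedFDeriv ℝ k φ (A n t)).compContinuousLinearMap fun _ => A n‖ ≤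
        C k * (2 ^ n) ^ k := by
      refine (ContinuousMultilinearMap.norm_compContinuousLinearMap_le _ _).trans ?_
      rw [Finset.prod_const, Finset.card_univ, Fintype.card_fin]
      have := hC k (A n t)
      have := hA n
      have := hC0 k
      gcongr
    calc _ ≤ ((2 : ℝ) ^ n)⁻¹ ^ (n + 1) * (C k * (2 ^ n) ^ k) := by gcongr
      _ = _ := by ring
  have hsum : ∀ k : ℕ, (k : ℕ∞) ≤ (⊤ : ℕ∞) → Summable fun n : ℕ =>
      C k * ((2 ^ n) ^ k * ((2 : ℝ) ^ n)⁻¹ ^ (n + 1)) := by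
    intro k _
    refine Summable.mul_left _ ?_
    refine Summable.of_norm_bounded_eventually_nat (g := fun n => (1 / 2 : ℝ) ^ n)
      (summable_geometric_of_lt_one (by norm_num) (by norm_num)) ?_
    filter_upwards [eventually_ge_atTop k] with n hn
    rw [Real.norm_eq_abs, abs_of_nonneg (by positivity)]
    have h1 : (1 : ℝ) ≤ 2 ^ n := one_le_pow₀ (by norm_num)
    calc (2 ^ n) ^ k * ((2 : ℝ) ^ n)⁻¹ ^ (n + 1) ≤ (2 ^ n) ^ n * ((2 : ℝ) ^ n)⁻¹ ^ (n + 1) := by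
          gcongr
      _ = ((2 : ℝ) ^ n)⁻¹ := by
          rw [pow_succ, ← mul_assoc, ← mul_pow, mul_inv_cancel₀ (by positivity)]; simp
      _ = (1 / 2 : ℝ) ^ n := by rw [one_div, inv_pow]
  refine ⟨fun t => ∑' n, F n t, contDiff_tsum (N := ⊤) hF hsum hFb, ?_, fun m => ?_⟩
  · have : ∀ n, F n 0 = 0 := fun n => by
      have : φ 0 = 0 := φ.zero_of_le_dist (by
        change (1 / 4 : ℝ) ≤ _
        rw [Real.dist_eq]; norm_num)
      simp [F, this]
    simp [this]
  · have : ∀ n, n ≠ m → F n ((2 ^ m)⁻¹) = 0 := fun n hn => by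
      have := bump_two_pow_mul_inv φ rfl n m
      rw [if_neg hn] at this
      simp [F, A, this]
    refine (tsum_eq_single m this).trans ?_
    have := bump_two_pow_mul_inv φ rfl m m
    rw [if_pos rfl] at this
    simp only [F, A, Function.comp_apply, FunLike.coe_smul, Pi.smul_apply,
      ContinuousLinearMap.id_apply, smul_eq_mul]
    rw [this, one_smul]

/-- If `x` were not interior, points outside `S` would converge to `x` fast enough to lie on a
smooth curve through `x`. -/
theorem isOpen_of_forall_smooth_curve [CompleteSpace Y] {S : Set Y}
    (hS : ∀ γ : ℝ → Y, ContDiff ℝ ∞ γ → IsOpen (γ ⁻¹' S)) : IsOpen S := by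
  rw [isOpen_iff_mem_nhds]
  intro x hx
  by_contra hcon
  have hex : ∀ n : ℕ, ∃ y, ‖y - x‖ ≤ ((2 : ℝ) ^ n)⁻¹ ^ (n + 1) ∧ y ∉ S := by
    intro n
    by_contra! h
    refine hcon (Filter.mem_of_superset (Metric.closedBall_mem_nhds x
      (show 0 < ((2 : ℝ) ^ n)⁻¹ ^ (n + 1) by positivity)) fun y hy => h y ?_)
    rwa [← dist_eq_norm]
  choose y hy hyS using hex
  obtain ⟨γ, hγ, hγ0, hγn⟩ := exists_smooth_curve_through hy
  have hopen := hS (fun t => x + γ t) (contDiff_const.add hγ)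
  have h0 : (0 : ℝ) ∈ (fun t => x + γ t) ⁻¹' S := by simpa [hγ0] using hx
  have hlim : Tendsto (fun n : ℕ => ((2 : ℝ) ^ n)⁻¹) atTop (𝓝 0) := by
    simpa using tendsto_pow_atTop_nhds_zero_of_lt_one (r := (2 : ℝ)⁻¹) (by norm_num) (by norm_num)
  obtain ⟨n, hn⟩ := (hlim.eventually (hopen.mem_nhds h0)).exists
  refine hyS n ?_
  have : x + γ ((2 ^ n)⁻¹) ∈ S := hn
  rwa [hγn, add_sub_cancel] at this

variable {E : Type*} [AddCommGroup E] [Module ℝ E] [TopologicalSpace E]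

theorem isSmoothCurve_of_contDiff {γ : ℝ → Y} (hγ : ContDiff ℝ ∞ γ) (j : Y →L[ℝ] E) :
    IsSmoothCurve fun t => j (γ t) := by
  refine ⟨fun k t => j (iteratedDeriv k γ t), by simp, fun k t => ?_⟩
  have h1 : HasDerivAt (iteratedDeriv k γ) (iteratedDeriv (k + 1) γ t) t := by
    rw [iteratedDeriv_succ]
    exact (hγ.differentiable_iteratedDeriv k (by exact_mod_cast ENat.natCast_lt_top _)
      t).hasDerivAt
  have h2 := (j.continuous.tendsto _).comp (hasDerivAt_iff_tendsto_slope.1 h1)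
  refine h2.congr fun s => ?_
  simp [slope_def_module]

variable [IsTopologicalAddGroup E] [ContinuousSMul ℝ E] [T2Space E]

theorem IsCInftyOpen.isOpen_preimage_incl {U : Set E} (hU : IsCInftyOpen U) (B : Disk E)
    [CompleteSpace B.Space] : IsOpen (B.incl ⁻¹' U) :=
  isOpen_of_forall_smooth_curve fun _ hγ => hU _ (isSmoothCurve_of_contDiff hγ B.inclL)

end SpecialCurve

/-- Completeness makes the closed convex hull compact; it stays in the open ball because the norm
attains its maximum on `K`. -/
theorem exists_convex_compact_subset_ball {G : Type*} [NormedAddCommGroup G] [NormedSpace ℝ G]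
    [CompleteSpace G] {K : Set G} (hK : IsCompact K) (hKb : K ⊆ Metric.ball 0 1) :
    ∃ K', IsCompact K' ∧ Convex ℝ K' ∧ K ⊆ K' ∧ K' ⊆ Metric.ball 0 1 := by
  refine ⟨closure (convexHull ℝ K), ?_, (convex_convexHull ℝ K).closure,
    (subset_convexHull ℝ K).trans subset_closure, ?_⟩
  · exact hK.totallyBounded.convexHull.closure.isCompact_of_isClosed isClosed_closure
  · obtain ⟨r, hr, hKr⟩ : ∃ r < 1, K ⊆ Metric.closedBall (0 : G) r := by
      rcases K.eq_empty_or_nonempty with rfl | hne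
      · exact ⟨0, one_pos, empty_subset _⟩
      · obtain ⟨x, hx, hmax⟩ := hK.exists_isMaxOn hne continuous_norm.continuousOn
        exact ⟨‖x‖, by simpa using hKb hx, fun y hy => by simpa using hmax hy⟩
    have := closure_minimal (convexHull_min hKr (convex_closedBall 0 r)) Metric.isClosed_closedBall
    exact this.trans (Metric.closedBall_subset_ball hr)

/-! ### Faà di Bruno's formula -/

section Composition

variable {W Y : Type*} [NormedAddCommGroup W] [NormedSpace ℝ W]
  [NormedAddCommGroup Y] [NormedSpace ℝ Y]

theorem iteratedFDerivWithin_comp_eq_sum {h : Y → ℝ} {γ : W → Y} {S : Set Y} {Ω : Set W}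
    (hS : IsOpen S) (hΩ : IsOpen Ω) (hh : ContDiffOn ℝ ∞ h S) (hγ : ContDiffOn ℝ ∞ γ Ω)
    (hm : MapsTo γ Ω S) {t : W} (ht : t ∈ Ω) (k : ℕ) (m : Fin k → W) :
    iteratedFDerivWithin ℝ k (h ∘ γ) Ω t m = ∑ c : OrderedFinpartition k,
      iteratedFDerivWithin ℝ c.length h S (γ t) fun i =>
        iteratedFDerivWithin ℝ (c.partSize i) γ Ω t (m ∘ c.emb i) := by
  have h1 := (hh.ftaylorSeriesWithin hS.uniqueDiffOn).comp
    (hγ.ftaylorSeriesWithin hΩ.uniqueDiffOn) hm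
  rw [← h1.eq_iteratedFDerivWithin_of_uniqueDiffOn (m := k) (by exact_mod_cast le_top)
    hΩ.uniqueDiffOn ht]
  simp only [FormalMultilinearSeries.taylorComp, sum_apply]
  rfl

end Composition

/-! ### Lifting a plot along finite-dimensional subspaces -/

section Local

variable {E : Type*} [AddCommGroup E] [Module ℝ E] [TopologicalSpace E]
  [IsTopologicalAddGroup E] [ContinuousSMul ℝ E] [T2Space E]
  {G : Type*} [NormedAddCommGroup G] [NormedSpace ℝ G] {τ : ClassType} {M : ℕ → ℝ} {D : Set G}

theorem exists_isAdmissible (τ : ClassType) : ∃ u, IsAdmissible τ u := by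
  cases τ with
  | beurling => exact ⟨fun _ => 1, monotone_const, fun _ => one_pos, fun _ => rfl⟩
  | roumieu =>
    exact ⟨fun k => (k : ℝ) + 1, fun i j hij => by simpa using hij, fun k => by positivity,
      tendsto_atTop_add_const_right _ _ tendsto_natCast_atTop_atTop⟩

/-- Finite-dimensional restrictions of a weakly `C^[M]` map lift locally to a smooth map into the
Banach space spanned by a weak disk, which may be taken larger than a given one. -/
theorem exists_local_lift [LocallyConvexSpace ℝ E] (hE : ∀ B : Disk E, CompleteSpace B.Space)
    (hM : ∀ k, 0 < M k) (hD : IsOpen D) {c : G → E}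
    (hc : ∀ ℓ : E →L[ℝ] ℝ, IsNormedClass τ M (fun x => ℓ (c x)) D)
    {b : (E →L[ℝ] ℝ) → ℝ} (hb : ∀ ℓ, 0 ≤ b ℓ) {x : G} (hx : x ∈ D) {n : ℕ}
    (P : (Fin n → ℝ) →L[ℝ] G) :
    ∃ (b' : (E →L[ℝ] ℝ) → ℝ) (hb' : ∀ ℓ, 0 ≤ b' ℓ) (Ω : Set (Fin n → ℝ))
      (γ : (Fin n → ℝ) → (weakDisk b' hb').Space), (∀ ℓ, b ℓ ≤ b' ℓ) ∧ IsOpen Ω ∧ 0 ∈ Ω ∧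
      (∀ t ∈ Ω, x + P t ∈ D) ∧ ContDiffOn ℝ ∞ γ Ω ∧
      ∀ t ∈ Ω, (weakDisk b' hb').incl (γ t) = c (x + P t) := by
  have hcont : Continuous fun t => x + P t := by fun_prop
  obtain ⟨δ, hδ, hδD⟩ : ∃ δ > 0, ∀ t ∈ Metric.closedBall (0 : Fin n → ℝ) δ, x + P t ∈ D := by
    have : (fun t => x + P t) ⁻¹' D ∈ 𝓝 0 := hcont.continuousAt.preimage_mem_nhds
      (by simpa using hD.mem_nhds hx)
    exact Metric.nhds_basis_closedBall.mem_iff.1 this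
  have hK : IsCompact ((fun t => x + P t) '' Metric.closedBall 0 δ) :=
    (isCompact_closedBall 0 δ).image hcont
  have hKD : (fun t => x + P t) '' Metric.closedBall 0 δ ⊆ D := image_subset_iff.2 hδD
  obtain ⟨u, hu⟩ := exists_isAdmissible τ
  choose C hC0 hC using fun ℓ =>
    ((isNormedClass_iff.1 (hc ℓ)).2 _ hK hKD).le_admissible hM hu
  -- The derivatives near `x` only satisfy the bounds `C ℓ`; the maximum keeps the given disk inside
  -- the new one.
  let b' : (E →L[ℝ] ℝ) → ℝ := fun ℓ => max (b ℓ) (C ℓ)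
  have hb' : ∀ ℓ, 0 ≤ b' ℓ := fun ℓ => (hb ℓ).trans (le_max_left _ _)
  have := hE (weakDisk b' hb')
  have hΩD : ∀ t ∈ Metric.ball (0 : Fin n → ℝ) δ, x + P t ∈ D := fun t ht =>
    hδD t (Metric.ball_subset_closedBall ht)
  obtain ⟨γ, hγ, hγ'⟩ := exists_smooth_lift hb' (Ω := Metric.ball (0 : Fin n → ℝ) δ)
    Metric.isOpen_ball (c := fun t => c (x + P t))
    (fun ℓ => (hc ℓ).1.comp (g := fun x => ℓ (c x))
      (by fun_prop : ContDiff ℝ ∞ fun t => x + P t).contDiffOn hΩD)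
    (fun k => k.factorial * u k ^ k * M k * ‖P‖ ^ k) (by
      intro ℓ t ht L
      have e := iteratedDir_map (fun x => ℓ (c x)) (P : (Fin n → ℝ) →ₗ[ℝ] G) x L t
      have e2 := abs_iteratedDir_le hD (hc ℓ).1 (hΩD t ht) (L.map P)
      have e3 := hC ℓ (x + P t) ⟨t, Metric.ball_subset_closedBall ht, rfl⟩ (L.map P).length
      have e4 := prod_map_norm_map_le P L
      simp only [ContinuousLinearMap.coe_coe] at e
      rw [← e]
      rw [List.length_map] at e2 e3
      have p1 := hC0 ℓ
      have p2 := hM L.length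
      have p3 := hu.pos L.length
      have p4 : 0 ≤ (L.map norm).prod := List.prod_nonneg (by simp)
      have p5 : 0 ≤ ((L.map P).map norm).prod := List.prod_nonneg (by simp)
      calc _ ≤ _ := e2
        _ ≤ C ℓ * (L.length.factorial * u L.length ^ L.length * M L.length) *
            (‖P‖ ^ L.length * (L.map norm).prod) := by gcongr
        _ ≤ b' ℓ * (L.length.factorial * u L.length ^ L.length * M L.length) *
            (‖P‖ ^ L.length * (L.map norm).prod) := by gcongr; exact le_max_right _ _
        _ = _ := by ring)
  exact ⟨b', hb', _, γ, fun ℓ => le_max_left _ _, Metric.isOpen_ball,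
    Metric.mem_ball_self hδ, hΩD, hγ, hγ'⟩

end Local

/-! ### Bounds for the derivatives of `ℓ ∘ f ∘ c` on compact convex sets -/

section Estimate

variable {E F : Type*} [AddCommGroup E] [Module ℝ E] [TopologicalSpace E]
  [IsTopologicalAddGroup E] [ContinuousSMul ℝ E] [T2Space E]
  [NormedAddCommGroup F] [NormedSpace ℝ F]
  {G : Type*} [NormedAddCommGroup G] [NormedSpace ℝ G] {τ : ClassType} {M : ℕ → ℝ}
  {D : Set G} {U : Set E} {f : E → F} {c : G → E}

/-- Along finite-dimensional subspaces, `ℓ ∘ f ∘ c` is smooth. -/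
theorem exists_contDiffOn_restriction (hE : IsConvenient E) (hM : ∀ k, 0 < M k)
    (hf : IsClass τ M f U) (hD : IsOpen D)
    (hc : ∀ ℓ : E →L[ℝ] ℝ, IsNormedClass τ M (fun x => ℓ (c x)) D) (hcU : MapsTo c D U)
    (ℓ : F →L[ℝ] ℝ) {x : G} (hx : x ∈ D) {n : ℕ} (P : (Fin n → ℝ) →L[ℝ] G) :
    ∃ Ω : Set (Fin n → ℝ), IsOpen Ω ∧ 0 ∈ Ω ∧
      ContDiffOn ℝ ∞ (fun t => ℓ (f (c (x + P t)))) Ω := by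
  have := hE.1
  obtain ⟨b, hb, Ω, γ, -, hΩ, h0, hΩD, hγ, hγc⟩ :=
    exists_local_lift hE.2 hM hD hc (b := 0) (fun _ => le_rfl) hx P
  refine ⟨Ω, hΩ, h0, ((hf.2 ℓ (weakDisk b hb)).1.comp hγ fun t ht => ?_).congr fun t ht => ?_⟩
  · change (weakDisk b hb).incl (γ t) ∈ U
    rw [hγc t ht]
    exact hcU (hΩD t ht)
  · simp only [Function.comp_apply, hγc t ht]

theorem hasDerivAt_iteratedDir_comp (hE : IsConvenient E) (hM : ∀ k, 0 < M k)
    (hf : IsClass τ M f U) (hD : IsOpen D)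
    (hc : ∀ ℓ : E →L[ℝ] ℝ, IsNormedClass τ M (fun x => ℓ (c x)) D) (hcU : MapsTo c D U)
    (ℓ : F →L[ℝ] ℝ) {x : G} (hx : x ∈ D) (h : G) (L : List G) :
    HasDerivAt (fun s : ℝ => iteratedDir (fun x => ℓ (f (c x))) L (x + s • h))
      (iteratedDir (fun x => ℓ (f (c x))) (h :: L) x) 0 := by
  obtain ⟨n, P, L', hL'⟩ := exists_map_eq (h :: L)
  obtain ⟨h', L', rfl⟩ : ∃ a l, L' = a :: l := by
    cases L' with
    | nil => simp at hL'
    | cons a l => exact ⟨a, l, rfl⟩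
  obtain ⟨rfl, rfl⟩ : P h' = h ∧ L'.map P = L := by simpa using hL'
  obtain ⟨Ω, hΩ, h0, hs⟩ := exists_contDiffOn_restriction hE hM hf hD hc hcU ℓ hx P
  have h1 := hasDerivAt_iteratedDir hΩ hs h0 h' L'
  have e : ∀ (L : List (Fin n → ℝ)) t, iteratedDir (fun x => ℓ (f (c x))) (L.map P) (x + P t) = _ :=
    iteratedDir_map (fun x => ℓ (f (c x))) (P : (Fin n → ℝ) →ₗ[ℝ] G) x
  have e0 := e (h' :: L') 0
  rw [map_zero, add_zero, List.map_cons] at e0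
  rw [e0]
  refine HasDerivAt.congr_of_eventuallyEq h1 (Eventually.of_forall fun s => ?_)
  have := e L' (0 + s • h')
  simpa using this

/-- A compact convex set is mapped by `c` to a compact subset of the space spanned by a weak disk
bounding the first derivatives. -/
theorem isCompact_preimage_image [LocallyConvexSpace ℝ E] (hD : IsOpen D)
    (hc : ∀ ℓ : E →L[ℝ] ℝ, ContDiffOn ℝ ∞ (fun x => ℓ (c x)) D) {K : Set G} (hK : IsCompact K)
    (hKc : Convex ℝ K) (hKD : K ⊆ D) {b : (E →L[ℝ] ℝ) → ℝ} (hb : ∀ ℓ, 0 ≤ b ℓ) {R₀ R₁ : ℝ}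
    (h0 : ∀ ℓ : E →L[ℝ] ℝ, ∀ x ∈ K, |ℓ (c x)| ≤ R₀ * b ℓ) (hR₁ : 0 ≤ R₁)
    (h1 : ∀ ℓ : E →L[ℝ] ℝ, ∀ x ∈ K, ‖fderiv ℝ (fun x => ℓ (c x)) x‖ ≤ R₁ * b ℓ) :
    IsCompact {y : (weakDisk b hb).Space | (weakDisk b hb).incl y ∈ c '' K} := by
  choose γ hγ using fun x : K => exists_weakDisk_incl_eq (hb := hb) (fun ℓ => h0 ℓ x x.2)
  have hlip : ∀ x y : K, dist (γ x) (γ y) ≤ R₁ * dist x y := by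
    intro x y
    rw [dist_eq_norm]
    refine norm_weakDisk_le (by positivity) fun ℓ => ?_
    rw [map_sub, hγ, hγ, map_sub]
    have := hKc.norm_image_sub_le_of_norm_fderiv_le (𝕜 := ℝ) (f := fun x => ℓ (c x))
      (fun z hz => (((hc ℓ).differentiableOn (by simp)) z (hKD hz)).differentiableAt
        (hD.mem_nhds (hKD hz))) (h1 ℓ) y.2 x.2
    calc _ ≤ _ := this
      _ = _ := by rw [Subtype.dist_eq, dist_eq_norm]; ring
  have hcont : Continuous γ := (LipschitzWith.of_dist_le' hlip).continuous
  have hKs : CompactSpace K := isCompact_iff_compactSpace.1 hK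
  have : {y : (weakDisk b hb).Space | (weakDisk b hb).incl y ∈ c '' K} = range γ := by
    ext y
    constructor
    · rintro ⟨x, hx, hxy⟩
      exact ⟨⟨x, hx⟩, (weakDisk b hb).incl_injective ((hγ ⟨x, hx⟩).trans hxy)⟩
    · rintro ⟨x, rfl⟩
      exact ⟨x, x.2, (hγ x).symm⟩
  rw [this]
  exact isCompact_range hcont

/-- Two disks are used. The one given by `b` depends only on `K` and yields all constants; the one
given by `b'` depends on the point and the directions, and serves only to make the chain rule
legitimate. -/
theorem exists_iteratedDir_comp_bound (hE : IsConvenient E) (hM : IsLogConvexWeight M)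
    (hU : IsCInftyOpen U) (hf : IsClass τ M f U) (hD : IsOpen D)
    (hc : ∀ ℓ : E →L[ℝ] ℝ, IsNormedClass τ M (fun x => ℓ (c x)) D) (hcU : MapsTo c D U)
    {w : ℕ → ℝ} (hw : IsAdmissible τ w) {K : Set G} (hK : IsCompact K) (hKc : Convex ℝ K)
    (hKD : K ⊆ D) (ℓ : F →L[ℝ] ℝ) :
    ∃ C : ℝ, ∀ x ∈ K, ∀ L : List G, |iteratedDir (fun x => ℓ (f (c x))) L x| ≤
      C * (L.length.factorial * w L.length ^ L.length * M L.length) * (L.map norm).prod := by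
  have := hE.1
  obtain ⟨u, v, hu, hv, huvw⟩ := hw.exists_factorization (hM.pos 1)
  choose b hb hbK using fun ℓ : E →L[ℝ] ℝ =>
    ((isNormedClass_iff.1 (hc ℓ)).2 _ hK hKD).le_admissible hM.pos hu
  have hcomp : IsCompact {y : (weakDisk b hb).Space | (weakDisk b hb).incl y ∈ c '' K} := by
    refine isCompact_preimage_image hD (fun ℓ => (hc ℓ).1) hK hKc hKD hb
      (R₀ := Nat.factorial 0 * u 0 ^ 0 * M 0) (R₁ := Nat.factorial 1 * u 1 ^ 1 * M 1)
      (fun ℓ x hx => ?_) ?_ fun ℓ x hx => ?_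
    · have := hbK ℓ x hx 0
      rwa [norm_iteratedFDerivWithin_zero, Real.norm_eq_abs, mul_comm] at this
    · have := hu.pos 1
      have := hM.pos 1
      positivity
    · have := hbK ℓ x hx 1
      rw [norm_iteratedFDerivWithin_one _ (hD.uniqueDiffOn x (hKD hx)), mul_comm] at this
      rwa [fderivWithin_of_isOpen hD (hKD hx)] at this
  have hsub : {y : (weakDisk b hb).Space | (weakDisk b hb).incl y ∈ c '' K} ⊆
      (weakDisk b hb).incl ⁻¹' U := by
    rintro y ⟨x, hx, hxy⟩
    change (weakDisk b hb).incl y ∈ U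
    rw [← hxy]
    exact hcU (hKD hx)
  obtain ⟨C, hC0, hC⟩ := ((isNormedClass_iff.1 (hf.2 ℓ (weakDisk b hb))).2 _ hcomp
    hsub).le_admissible hM.pos hv
  refine ⟨C, fun x hx L => ?_⟩
  obtain ⟨n, P, L, rfl⟩ := exists_map_eq L
  obtain ⟨b', hb', Ω, γ, hbb', hΩ, h0, hΩD, hγ, hγc⟩ :=
    exists_local_lift hE.2 hM.pos hD hc hb (hKD hx) P
  obtain ⟨j, hj⟩ := exists_weakDisk_inclusion (hb := hb) (hb' := hb') hbb'
  have := hE.2 (weakDisk b hb)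
  have := hE.2 (weakDisk b' hb')
  have hSb : IsOpen ((weakDisk b hb).incl ⁻¹' U) := hU.isOpen_preimage_incl _
  have hSb' : IsOpen ((weakDisk b' hb').incl ⁻¹' U) := hU.isOpen_preimage_incl _
  set h : (weakDisk b' hb').Space → ℝ := fun y => ℓ (f ((weakDisk b' hb').incl y)) with hh
  have hhs : ContDiffOn ℝ ∞ h ((weakDisk b' hb').incl ⁻¹' U) := (hf.2 ℓ _).1
  have hmaps : MapsTo γ Ω ((weakDisk b' hb').incl ⁻¹' U) := fun t ht => by
    change (weakDisk b' hb').incl (γ t) ∈ U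
    rw [hγc t ht]
    exact hcU (hΩD t ht)
  -- the derivatives of `γ` at `0` come from elements of the smaller space
  have inner : ∀ L : List (Fin n → ℝ), ∃ z : (weakDisk b hb).Space,
      j z = iteratedFDerivWithin ℝ L.length γ Ω 0 L.get ∧
      ‖z‖ ≤ (L.length.factorial * u L.length ^ L.length * M L.length) *
        ((L.map P).map norm).prod := by
    intro L
    have hbd : ∀ l : E →L[ℝ] ℝ, |l ((weakDisk b' hb').incl
        (iteratedFDerivWithin ℝ L.length γ Ω 0 L.get))| ≤
        (L.length.factorial * u L.length ^ L.length * M L.length) *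
        ((L.map P).map norm).prod * b l := by
      intro l
      have e1 : l ((weakDisk b' hb').incl (iteratedFDerivWithin ℝ L.length γ Ω 0 L.get)) =
          iteratedFDerivWithin ℝ L.length ((l.comp (weakDisk b' hb').inclL) ∘ γ) Ω 0 L.get := by
        rw [ContinuousLinearMap.iteratedFDerivWithin_comp_left _ (hγ 0 h0) hΩ.uniqueDiffOn h0
          (by exact_mod_cast le_top)]
        rfl
      have e2 : iteratedFDerivWithin ℝ L.length ((l.comp (weakDisk b' hb').inclL) ∘ γ) Ω 0 L.get =
          iteratedDir (fun x => l (c x)) (L.map P) x := by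
        rw [← iteratedDir_eq hΩ ((l.comp (weakDisk b' hb').inclL).contDiff.comp_contDiffOn hγ) L 0
          h0]
        have e3 := iteratedDir_map (fun x => l (c x)) (P : (Fin n → ℝ) →ₗ[ℝ] G) x L 0
        rw [map_zero, add_zero] at e3
        refine Eq.trans ?_ e3.symm
        refine iteratedDir_congr hΩ (fun t ht => ?_) L 0 h0
        exact congrArg l (hγc t ht)
      rw [e1, e2]
      have e4 := abs_iteratedDir_le hD (hc l).1 (hKD hx) (L.map P)
      have e5 := hbK l x hx (L.map P).length
      have p5 : 0 ≤ ((L.map P).map norm).prod := List.prod_nonneg (by simp)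
      rw [List.length_map] at e4 e5
      calc _ ≤ _ := e4
        _ ≤ _ := mul_le_mul_of_nonneg_right e5 p5
        _ = _ := by ring
    obtain ⟨z, hz⟩ := exists_weakDisk_incl_eq (hb := hb) hbd
    refine ⟨z, (weakDisk b' hb').incl_injective ((hj z).trans hz), norm_weakDisk_le ?_ ?_⟩
    · have := hu.pos L.length
      have := hM.pos L.length
      have p5 : 0 ≤ ((L.map P).map norm).prod := List.prod_nonneg (by simp)
      positivity
    · rw [hz]; exact hbd
  obtain ⟨y₀, hy₀⟩ : ∃ y₀, (weakDisk b hb).incl y₀ = c x := by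
    refine exists_weakDisk_incl_eq (r := Nat.factorial 0 * u 0 ^ 0 * M 0) fun l => ?_
    have := hbK l x hx 0
    rwa [norm_iteratedFDerivWithin_zero, Real.norm_eq_abs, mul_comm] at this
  have hjy₀ : γ 0 = j y₀ := by
    refine (weakDisk b' hb').incl_injective ?_
    rw [hj, hy₀, hγc 0 h0, map_zero, add_zero]
  have hy₀U : y₀ ∈ (weakDisk b hb).incl ⁻¹' U := hsub ⟨x, hx, hy₀.symm⟩
  -- In directions coming from the smaller space, the derivatives of `h` are those of its
  -- restriction along `j`. They are evaluated at a point of the compact preimage of `c(K)`, where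
  -- `C` applies independently of `P`.
  have outer : ∀ k (z : Fin k → (weakDisk b hb).Space),
      |iteratedFDerivWithin ℝ k h ((weakDisk b' hb').incl ⁻¹' U) (γ 0) fun i => j (z i)| ≤
      C * (k.factorial * v k ^ k * M k) * ∏ i, ‖z i‖ := by
    intro k z
    have hset : j ⁻¹' ((weakDisk b' hb').incl ⁻¹' U) = (weakDisk b hb).incl ⁻¹' U := by
      ext y; simp only [mem_preimage, hj]
    have e1 := ContinuousLinearMap.iteratedFDerivWithin_comp_right j hhs hSb'.uniqueDiffOn
      (by rw [hset]; exact hSb.uniqueDiffOn) (x := y₀) (by rw [← hjy₀]; exact hmaps h0) (i := k)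
      (by exact_mod_cast le_top)
    have hfun : h ∘ j = fun y => ℓ (f ((weakDisk b hb).incl y)) := by
      ext y; simp only [hh, Function.comp_apply, hj]
    rw [hset, hfun, ← hjy₀] at e1
    have e2 : iteratedFDerivWithin ℝ k h ((weakDisk b' hb').incl ⁻¹' U) (γ 0) (fun i => j (z i)) =
        iteratedFDerivWithin ℝ k (fun y => ℓ (f ((weakDisk b hb).incl y)))
          ((weakDisk b hb).incl ⁻¹' U) y₀ z := by
      rw [e1]; rfl
    rw [e2]
    refine ((iteratedFDerivWithin ℝ k (fun y => ℓ (f ((weakDisk b hb).incl y)))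
      ((weakDisk b hb).incl ⁻¹' U) y₀).le_opNorm z).trans ?_
    have := hC y₀ ⟨x, hx, hy₀.symm⟩ k
    have p : 0 ≤ ∏ i, ‖z i‖ := Finset.prod_nonneg fun i _ => norm_nonneg _
    exact mul_le_mul_of_nonneg_right this p
  have e3 := iteratedDir_map (fun x => ℓ (f (c x))) (P : (Fin n → ℝ) →ₗ[ℝ] G) x L 0
  rw [map_zero, add_zero] at e3
  have e4 : iteratedDir (fun t => ℓ (f (c (x + P t)))) L 0 = iteratedDir (h ∘ γ) L 0 :=
    iteratedDir_congr hΩ (fun t ht => by simp only [hh, Function.comp_apply, hγc t ht]) L 0 h0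
  have e5 := iteratedDir_eq hΩ (hhs.comp hγ hmaps) L 0 h0
  have e6 : iteratedDir (fun x => ℓ (f (c x))) (L.map P) x = ∑ p : OrderedFinpartition L.length,
      iteratedFDerivWithin ℝ p.length h ((weakDisk b' hb').incl ⁻¹' U) (γ 0) fun i =>
        iteratedFDerivWithin ℝ (p.partSize i) γ Ω 0 (L.get ∘ p.emb i) := by
    rw [← iteratedFDerivWithin_comp_eq_sum hSb' hΩ hhs hγ hmaps h0 L.length L.get, ← e5, ← e4]
    exact e3
  rw [e6, List.length_map]
  have hprod : ∀ L : List (Fin n → ℝ), ∏ i, ‖P (L.get i)‖ = ((L.map P).map norm).prod := by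
    intro L
    rw [← List.prod_ofFn, List.map_map, ← Function.comp_def (fun y => ‖P y‖) L.get,
      ← List.map_ofFn, List.ofFn_get]
    rfl
  have inner' : ∀ (k : ℕ) (m : Fin k → Fin n → ℝ), ∃ z : (weakDisk b hb).Space,
      j z = iteratedFDerivWithin ℝ k γ Ω 0 m ∧
      ‖z‖ ≤ (k.factorial * u k ^ k * M k) * ∏ i, ‖P (m i)‖ := by
    intro k m
    obtain ⟨L, hL, hm⟩ : ∃ (L : List (Fin n → ℝ)) (hL : L.length = k),
        m = fun i => L.get (Fin.cast hL.symm i) :=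
      ⟨List.ofFn m, List.length_ofFn, by ext i; simp⟩
    subst hL
    have hm' : m = L.get := hm
    rw [hm', hprod]
    exact inner L
  have hterm : ∀ p : OrderedFinpartition L.length,
      |iteratedFDerivWithin ℝ p.length h ((weakDisk b' hb').incl ⁻¹' U) (γ 0) fun i =>
        iteratedFDerivWithin ℝ (p.partSize i) γ Ω 0 (L.get ∘ p.emb i)| ≤
      C * ((L.map P).map norm).prod *
      ((p.length.factorial : ℝ) * v p.length ^ p.length * M p.length *
      ∏ i, ((p.partSize i).factorial * u (p.partSize i) ^ (p.partSize i) * M (p.partSize i))) := by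
    intro p
    choose z hz hzn using fun i => inner' (p.partSize i) (L.get ∘ p.emb i)
    have e7 : (fun i => iteratedFDerivWithin ℝ (p.partSize i) γ Ω 0 (L.get ∘ p.emb i)) =
        fun i => j (z i) := funext fun i => (hz i).symm
    rw [e7]
    have hvp := hv.pos p.length
    have hMp := hM.pos p.length
    have e8 : ∏ i, ‖z i‖ ≤ (∏ i, ((p.partSize i).factorial * u (p.partSize i) ^ (p.partSize i) *
        M (p.partSize i))) * ((L.map P).map norm).prod := by
      rw [← hprod, ← p.prod_sigma_eq_prod fun i => ‖P (L.get i)‖, ← Finset.prod_mul_distrib]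
      exact Finset.prod_le_prod (fun i _ => norm_nonneg _) fun i _ => hzn i
    calc _ ≤ _ := outer p.length z
      _ ≤ C * (p.length.factorial * v p.length ^ p.length * M p.length) *
          ((∏ i, ((p.partSize i).factorial * u (p.partSize i) ^ (p.partSize i) *
          M (p.partSize i))) * ((L.map P).map norm).prod) := by gcongr
      _ = _ := by ring
  have p5 : 0 ≤ ((L.map P).map norm).prod := List.prod_nonneg (by simp)
  calc _ ≤ ∑ p : OrderedFinpartition L.length, _ := Finset.abs_sum_le_sum_abs _ _
    _ ≤ ∑ p : OrderedFinpartition L.length, C * ((L.map P).map norm).prod *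
      ((p.length.factorial : ℝ) * v p.length ^ p.length * M p.length *
      ∏ i, ((p.partSize i).factorial * u (p.partSize i) ^ (p.partSize i) * M (p.partSize i))) :=
        Finset.sum_le_sum fun p _ => hterm p
    _ = C * ((L.map P).map norm).prod * ∑ p : OrderedFinpartition L.length,
      ((p.length.factorial : ℝ) * v p.length ^ p.length * M p.length *
      ∏ i, ((p.partSize i).factorial * u (p.partSize i) ^ (p.partSize i) * M (p.partSize i))) := by
        rw [Finset.mul_sum]
    _ ≤ C * ((L.map P).map norm).prod *
        (L.length.factorial * w L.length ^ L.length * M L.length) := by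
        gcongr
        exact sum_composition_le hM hu.mono hu.pos hv.mono hv.pos (huvw _)
    _ = _ := by ring

end Estimate

/-! ### Composition with linear maps; normed spaces as convenient spaces -/

section Linear

variable {G G' H H' : Type*} [NormedAddCommGroup G] [NormedSpace ℝ G]
  [NormedAddCommGroup G'] [NormedSpace ℝ G'] [NormedAddCommGroup H] [NormedSpace ℝ H]
  [NormedAddCommGroup H'] [NormedSpace ℝ H'] {τ : ClassType} {M : ℕ → ℝ} {f : G → H} {U : Set G}

theorem IsAdmissible.const_mul {u : ℕ → ℝ} (hu : IsAdmissible τ u) {a : ℝ} (ha : 0 < a) :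
    IsAdmissible τ fun k => a * u k where
  mono _ _ hij := mul_le_mul_of_nonneg_left (hu.mono hij) ha.le
  pos k := mul_pos ha (hu.pos k)
  growth := by
    cases τ with
    | beurling => exact fun k => congrArg (a * ·) (hu.growth k)
    | roumieu => exact Tendsto.const_mul_atTop ha hu.growth

/-- The factor `‖A‖ ^ k` is absorbed by rescaling the admissible sequence by `(‖A‖ + 1)⁻¹`, where
the `1` guards against `A = 0`. -/
theorem IsNormedClass.comp_continuousLinearMap (hf : IsNormedClass τ M f U) (hM : ∀ k, 0 < M k)
    (hU : IsOpen U) (A : G' →L[ℝ] G) : IsNormedClass τ M (fun x => f (A x)) (A ⁻¹' U) := by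
  refine isNormedClass_iff.2 ⟨hf.1.comp_continuousLinearMap A, fun K hK hKU => ?_⟩
  refine isClassBound_of_forall_admissible hM (fun _ _ => norm_nonneg _) fun u hu => ?_
  have hA : 0 < ‖A‖ + 1 := by positivity
  obtain ⟨C, hC0, hC⟩ := ((isNormedClass_iff.1 hf).2 _ (hK.image A.continuous)
    (image_subset_iff.2 hKU)).le_admissible hM (hu.const_mul (inv_pos.2 hA))
  refine ⟨C, fun x hx k => ?_⟩
  have h1 := ContinuousLinearMap.iteratedFDerivWithin_comp_right A hf.1 hU.uniqueDiffOn
    (hU.preimage A.continuous).uniqueDiffOn (hKU hx) (i := k) (by exact_mod_cast le_top)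
  change ‖iteratedFDerivWithin ℝ k (f ∘ A) (A ⁻¹' U) x‖ ≤ _
  rw [h1]
  refine (ContinuousMultilinearMap.norm_compContinuousLinearMap_le _ _).trans ?_
  rw [Finset.prod_const, Finset.card_univ, Fintype.card_fin]
  have h2 := hC (A x) ⟨x, hx, rfl⟩ k
  have hMk := hM k
  have huk := hu.pos k
  calc _ ≤ C * (k.factorial * ((‖A‖ + 1)⁻¹ * u k) ^ k * M k) * (‖A‖ + 1) ^ k := by
        gcongr; linarith
    _ = C * (k.factorial * u k ^ k * M k) := by
        rw [mul_pow, inv_pow]; field_simp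

theorem IsNormedClass.continuousLinearMap_comp (hf : IsNormedClass τ M f U) (hM : ∀ k, 0 < M k)
    (hU : IsOpen U) (ℓ : H →L[ℝ] H') : IsNormedClass τ M (fun x => ℓ (f x)) U := by
  refine isNormedClass_iff.2 ⟨ℓ.contDiff.comp_contDiffOn hf.1, fun K hK hKU => ?_⟩
  refine isClassBound_of_forall_admissible hM (fun _ _ => norm_nonneg _) fun u hu => ?_
  obtain ⟨C, hC0, hC⟩ := ((isNormedClass_iff.1 hf).2 _ hK hKU).le_admissible hM hu
  refine ⟨‖ℓ‖ * C, fun x hx k => ?_⟩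
  have h1 := ContinuousLinearMap.iteratedFDerivWithin_comp_left ℓ (hf.1 x (hKU hx))
    hU.uniqueDiffOn (hKU hx) (i := k) (by exact_mod_cast le_top)
  change ‖iteratedFDerivWithin ℝ k (ℓ ∘ f) U x‖ ≤ _
  rw [h1, mul_assoc]
  exact (ContinuousLinearMap.norm_compContinuousMultilinearMap_le _ _).trans
    (mul_le_mul_of_nonneg_left (hC x hx k) (norm_nonneg _))

/-- The closed unit ball of a normed space. -/
def unitDisk (G : Type*) [NormedAddCommGroup G] [NormedSpace ℝ G] : Disk G where
  carrier := Metric.closedBall 0 1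
  nonempty := ⟨0, by simp⟩
  isClosed := Metric.isClosed_closedBall
  absConvex := ⟨balanced_closedBall_zero, convex_closedBall 0 1⟩
  bounded := NormedSpace.isVonNBounded_closedBall ℝ G 1

theorem exists_unitDisk_section (G : Type*) [NormedAddCommGroup G] [NormedSpace ℝ G] :
    ∃ A : G →L[ℝ] (unitDisk G).Space, ∀ x, (unitDisk G).incl (A x) = x := by
  have hmem : ∀ x : G, (‖x‖ + 1)⁻¹ • x ∈ (unitDisk G).carrier := fun x => by
    change _ ∈ Metric.closedBall (0 : G) 1
    rw [mem_closedBall_zero_iff, norm_smul, norm_inv, Real.norm_eq_abs,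
      abs_of_pos (by positivity), inv_mul_le_iff₀ (by positivity)]
    linarith
  have hspan : ∀ x, x ∈ Submodule.span ℝ (unitDisk G).carrier := fun x => by
    have := Submodule.smul_mem _ (‖x‖ + 1) (Submodule.subset_span (hmem x))
    rwa [smul_inv_smul₀ (by positivity)] at this
  let A : G →ₗ[ℝ] (unitDisk G).Space :=
    { toFun := fun x => (⟨x, hspan x⟩ : ↥(Submodule.span ℝ (unitDisk G).carrier))
      map_add' := fun _ _ => rfl
      map_smul' := fun _ _ => rfl }
  refine ⟨A.mkContinuous 1 fun x => ?_, fun x => rfl⟩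
  rw [one_mul]
  refine le_of_forall_gt_imp_ge_of_dense fun r hr => ?_
  have hr0 := (norm_nonneg x).trans_lt hr
  refine (unitDisk G).norm_le_of_incl_mem_smul hr0.le (y := r⁻¹ • x) ?_
    (smul_inv_smul₀ hr0.ne' _).symm
  change _ ∈ Metric.closedBall (0 : G) 1
  rw [mem_closedBall_zero_iff, norm_smul, norm_inv, Real.norm_eq_abs, abs_of_pos hr0,
    inv_mul_le_iff₀ hr0]
  linarith

/-- The span of the closed unit ball is all of `G`, so testing on this one disk gives back the
normed notion. -/
theorem IsClass.isNormedClass_apply {E : Type*} [AddCommGroup E] [Module ℝ E] [TopologicalSpace E]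
    {c : G → E} (hc : IsClass τ M c U) (hM : ∀ k, 0 < M k) (hU : IsOpen U) (ℓ : E →L[ℝ] ℝ) :
    IsNormedClass τ M (fun x => ℓ (c x)) U := by
  obtain ⟨A, hA⟩ := exists_unitDisk_section G
  have h1 := (hc.2 ℓ (unitDisk G)).comp_continuousLinearMap hM
    (hU.preimage (unitDisk G).continuous_incl) A
  have h2 : A ⁻¹' ((unitDisk G).incl ⁻¹' U) = U := by
    ext x; simp only [mem_preimage, hA]
  simpa only [h2, hA] using h1

end Linear

/-! ### Uniformity in the functional -/

section Bidual

/-- Banach–Steinhaus for the operators `(β i)⁻¹ • T i`. Indices with `β i = 0` are read off from the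
pointwise bound, which forces `T i = 0`. -/
theorem exists_bound_mul_of_pointwise {X ι : Type*} [NormedAddCommGroup X] [NormedSpace ℝ X]
    [CompleteSpace X] (T : ι → X →L[ℝ] ℝ) {β : ι → ℝ} (hβ : ∀ i, 0 ≤ β i)
    (h : ∀ x, ∃ C, ∀ i, |T i x| ≤ C * β i) :
    ∃ C, 0 ≤ C ∧ ∀ i x, |T i x| ≤ C * ‖x‖ * β i := by
  obtain ⟨C, hC⟩ := banach_steinhaus (g := fun i => (β i)⁻¹ • T i) fun x => by
    obtain ⟨C, hC⟩ := h x
    refine ⟨max C 0, fun i => ?_⟩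
    rcases (hβ i).eq_or_lt with h0 | h0
    · simp [← h0]
    · rw [FunLike.coe_smul, Pi.smul_apply, norm_smul, norm_inv, Real.norm_eq_abs,
        Real.norm_eq_abs, abs_of_pos h0, inv_mul_le_iff₀ h0, mul_comm]
      exact (hC i).trans (by gcongr; exact le_max_left _ _)
  refine ⟨max C 0, le_max_right _ _, fun i x => ?_⟩
  rcases (hβ i).eq_or_lt with h0 | h0
  · obtain ⟨C', hC'⟩ := h x
    have := hC' i
    rw [← h0, mul_zero] at this ⊢
    exact this
  · have h1 := ContinuousLinearMap.le_of_opNorm_le _ (hC i) x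
    rw [FunLike.coe_smul, Pi.smul_apply, norm_smul, norm_inv, Real.norm_eq_abs,
        Real.norm_eq_abs, abs_of_pos h0, inv_mul_le_iff₀ h0, mul_comm] at h1
    exact h1.trans (by gcongr; exact le_max_left _ _)

variable {G F : Type*} [NormedAddCommGroup G] [NormedSpace ℝ G]
  [NormedAddCommGroup F] [NormedSpace ℝ F] {D : Set G} {g : G → F}

/-- Each new derivative is a pointwise limit of difference quotients of bounded functionals on the
dual of `F`, hence bounded by Banach–Steinhaus. Differentiability of `g` itself is not yet known
here. -/
theorem exists_bidual_eq_iteratedDir (hD : IsOpen D)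
    (hg : ∀ ℓ : F →L[ℝ] ℝ, ∀ x ∈ D, ∀ h L, HasDerivAt
      (fun s : ℝ => iteratedDir (fun x => ℓ (g x)) L (x + s • h))
      (iteratedDir (fun x => ℓ (g x)) (h :: L) x) 0) (L : List G) :
    ∀ x ∈ D, ∃ T : (F →L[ℝ] ℝ) →L[ℝ] ℝ, ∀ ℓ : F →L[ℝ] ℝ,
      T ℓ = iteratedDir (fun x => ℓ (g x)) L x := by
  induction L with
  | nil =>
    intro x _
    exact ⟨ContinuousLinearMap.apply ℝ ℝ (g x), fun ℓ => rfl⟩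
  | cons h L ih =>
    intro x hx
    have hex : ∀ y, ∃ T : (F →L[ℝ] ℝ) →L[ℝ] ℝ, y ∈ D → ∀ ℓ : F →L[ℝ] ℝ,
        T ℓ = iteratedDir (fun x => ℓ (g x)) L y := by
      intro y
      by_cases hy : y ∈ D
      · obtain ⟨T, hT⟩ := ih y hy
        exact ⟨T, fun _ => hT⟩
      · exact ⟨0, fun h => absurd h hy⟩
    choose T hT using hex
    let s : ℕ → ℝ := fun n => 1 / ((n : ℝ) + 1)
    have hs : Tendsto s atTop (𝓝[≠] 0) := tendsto_nhdsWithin_iff.2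
      ⟨tendsto_one_div_add_atTop_nhds_zero_nat, Eventually.of_forall fun n =>
        (Nat.one_div_pos_of_nat (α := ℝ)).ne'⟩
    let q : ℕ → (F →L[ℝ] ℝ) →L[ℝ] ℝ := fun n => (s n)⁻¹ • (T (x + s n • h) - T x)
    have hq : Tendsto (fun n ℓ => q n ℓ) atTop
        (𝓝 fun ℓ : F →L[ℝ] ℝ => iteratedDir (fun x => ℓ (g x)) (h :: L) x) := by
      rw [tendsto_pi_nhds]
      intro ℓ
      refine ((hg ℓ x hx h L).tendsto_slope_zero.comp hs).congr' ?_
      filter_upwards [(hs.mono_right nhdsWithin_le_nhds).eventually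
        (eventually_add_smul_mem hD hx h)] with n hn
      simp only [Function.comp_apply, zero_add, zero_smul, add_zero, q]
      rw [FunLike.coe_smul, Pi.smul_apply, FunLike.coe_sub, Pi.sub_apply, hT _ hn ℓ, hT _ hx ℓ]
    exact ⟨continuousLinearMapOfTendsto q hq, fun ℓ => rfl⟩

end Bidual

/-! ### The composite with a plot -/

section Main

variable {E F : Type*} [AddCommGroup E] [Module ℝ E] [TopologicalSpace E]
  [IsTopologicalAddGroup E] [ContinuousSMul ℝ E] [T2Space E]
  [NormedAddCommGroup F] [NormedSpace ℝ F]
  {G : Type*} [NormedAddCommGroup G] [NormedSpace ℝ G] {τ : ClassType} {M : ℕ → ℝ}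

theorem iteratedFDerivWithin_eq_iteratedDir_ofFn {V : Type*} [NormedAddCommGroup V]
    [NormedSpace ℝ V] {φ : V → ℝ}
    {D : Set V} (hD : IsOpen D) (hφ : ContDiffOn ℝ ∞ φ D) {x : V} (hx : x ∈ D) {k : ℕ}
    (v : Fin k → V) : iteratedFDerivWithin ℝ k φ D x v = iteratedDir φ (List.ofFn v) x := by
  obtain ⟨L, hL, hv⟩ : ∃ (L : List V) (hL : L.length = k),
      v = fun i => L.get (Fin.cast hL.symm i) :=
    ⟨List.ofFn v, List.length_ofFn, by ext i; simp⟩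
  subst hL
  have hv' : v = L.get := hv
  rw [hv', List.ofFn_get, iteratedDir_eq hD hφ L x hx]

theorem isNormedClass_comp_plot [CompleteSpace F] [CompleteSpace G] (hE : IsConvenient E)
    (hM : IsLogConvexWeight M) {U : Set E} (hU : IsCInftyOpen U) {f : E → F}
    (hf : IsClass τ M f U) {c : G → E}
    (hc : ∀ ℓ : E →L[ℝ] ℝ, IsNormedClass τ M (fun x => ℓ (c x)) (Metric.ball 0 1))
    (hcU : MapsTo c (Metric.ball 0 1) U) :
    IsNormedClass τ M (f ∘ c) (Metric.ball 0 1) := by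
  set D : Set G := Metric.ball 0 1 with hDdef
  have hD : IsOpen D := Metric.isOpen_ball
  have hder : ∀ ℓ : F →L[ℝ] ℝ, ∀ x ∈ D, ∀ h L, HasDerivAt
      (fun s : ℝ => iteratedDir (fun x => ℓ ((f ∘ c) x)) L (x + s • h))
      (iteratedDir (fun x => ℓ ((f ∘ c) x)) (h :: L) x) 0 := fun ℓ x hx h L =>
    hasDerivAt_iteratedDir_comp hE hM.pos hf hD hc hcU ℓ hx h L
  -- Uniform boundedness over all points of `K'` and all lists `L` at once, with the growth rate as
  -- weight, makes the constant linear in `‖ℓ‖`.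
  have hunif : ∀ u, IsAdmissible τ u → ∀ K, IsCompact K → K ⊆ D → ∃ C, 0 ≤ C ∧
      ∀ x ∈ K, ∀ (ℓ : F →L[ℝ] ℝ) (L : List G), |iteratedDir (fun x => ℓ ((f ∘ c) x)) L x| ≤
        C * ‖ℓ‖ * ((L.length.factorial * u L.length ^ L.length * M L.length) *
          (L.map norm).prod) := by
    intro u hu K hK hKD
    obtain ⟨K', hK', hconv, hKK', hK'D⟩ := exists_convex_compact_subset_ball hK hKD
    choose T hT using fun i : K' × List G =>
      exists_bidual_eq_iteratedDir hD hder i.2 i.1.1 (hK'D i.1.2)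
    have hpos : ∀ L : List G, 0 ≤
        (L.length.factorial * u L.length ^ L.length * M L.length) * (L.map norm).prod := by
      intro L
      have h1 := hu.pos L.length
      have h2 := hM.pos L.length
      have h3 : 0 ≤ (L.map norm).prod := List.prod_nonneg (by simp)
      positivity
    obtain ⟨C, hC0, hC⟩ := exists_bound_mul_of_pointwise T (fun i => hpos i.2) (by
      intro ℓ
      obtain ⟨C, hC⟩ := exists_iteratedDir_comp_bound hE hM hU hf hD hc hcU hu hK' hconv hK'D ℓ
      refine ⟨C, fun i => ?_⟩
      rw [hT, ← mul_assoc]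
      exact hC i.1 i.1.2 i.2)
    refine ⟨C, hC0, fun x hx ℓ L => ?_⟩
    have := hC (⟨x, hKK' hx⟩, L) ℓ
    rwa [hT] at this
  have hsmooth : ContDiffOn ℝ ∞ (f ∘ c) D := by
    refine IsTower.contDiffOn hD (Λ := fun ℓ : F →L[ℝ] ℝ => ℓ) (β := fun ℓ => ‖ℓ‖)
      (τ := fun ℓ x L => iteratedDir (fun x => ℓ ((f ∘ c) x)) L x)
      ⟨fun ℓ x _ => rfl, hder, ?_⟩ (fun ℓ => norm_nonneg ℓ)
      fun y r hr h => NormedSpace.norm_le_dual_bound ℝ y hr h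
    intro k x₀ hx₀
    -- Estimates are available only on compact sets. If local boundedness failed at `x₀`, there
    -- would be violating points `x n → x₀`; together with `x₀` they form a compact set,
    -- contradicting `hunif`.
    by_contra! hcon
    have hex : ∀ n : ℕ, ∃ x, dist x x₀ < 1 / ((n : ℝ) + 1) ∧ x ∈ D ∧ ∃ (ℓ : F →L[ℝ] ℝ)
        (L : List G), L.length = k ∧
        n * ‖ℓ‖ * (L.map norm).prod < |iteratedDir (fun x => ℓ ((f ∘ c) x)) L x| := by
      intro n
      have h1 : ∀ᶠ x in 𝓝 x₀, dist x x₀ < 1 / ((n : ℝ) + 1) ∧ x ∈ D :=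
        Filter.inter_mem (Metric.ball_mem_nhds x₀ Nat.one_div_pos_of_nat) (hD.mem_nhds hx₀)
      obtain ⟨x, hx, hx1, hx2⟩ := ((hcon n).and_eventually h1).exists
      exact ⟨x, hx1, hx2, hx⟩
    choose x hxd hxD ℓ L hL hlt using hex
    have hlim : Tendsto x atTop (𝓝 x₀) := by
      rw [tendsto_iff_dist_tendsto_zero]
      exact squeeze_zero (fun _ => dist_nonneg) (fun n => (hxd n).le)
        tendsto_one_div_add_atTop_nhds_zero_nat
    obtain ⟨u, hu⟩ := exists_isAdmissible τ
    obtain ⟨C, hC0, hC⟩ := hunif u hu _ hlim.isCompact_insert_range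
      (insert_subset hx₀ (range_subset_iff.2 hxD))
    obtain ⟨n, hn⟩ := exists_nat_ge (C * (k.factorial * u k ^ k * M k))
    have h1 := hC (x n) (mem_insert_of_mem _ (mem_range_self n)) (ℓ n) (L n)
    rw [hL] at h1
    have h2 : 0 ≤ ((L n).map norm).prod := List.prod_nonneg (by simp)
    refine absurd (hlt n) (not_lt.2 (h1.trans ?_))
    calc _ = C * (k.factorial * u k ^ k * M k) * (‖ℓ n‖ * ((L n).map norm).prod) := by ring
      _ ≤ n * (‖ℓ n‖ * ((L n).map norm).prod) := by gcongr
      _ = _ := by ring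
  refine isNormedClass_iff.2 ⟨hsmooth, fun K hK hKD => ?_⟩
  refine isClassBound_of_forall_admissible hM.pos (fun _ _ => norm_nonneg _) fun u hu => ?_
  obtain ⟨C, hC0, hC⟩ := hunif u hu K hK hKD
  refine ⟨C, fun x hx k => ?_⟩
  have huk := hu.pos k
  have hMk := hM.pos k
  refine ContinuousMultilinearMap.opNorm_le_bound (by positivity) fun v => ?_
  refine NormedSpace.norm_le_dual_bound ℝ _ (by positivity) fun ℓ => ?_
  have h1 : ℓ (iteratedFDerivWithin ℝ k (f ∘ c) D x v) =
      iteratedFDerivWithin ℝ k (ℓ ∘ (f ∘ c)) D x v := by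
    rw [ContinuousLinearMap.iteratedFDerivWithin_comp_left ℓ (hsmooth x (hKD hx))
      hD.uniqueDiffOn (hKD hx) (by exact_mod_cast le_top)]
    rfl
  rw [h1, iteratedFDerivWithin_eq_iteratedDir_ofFn hD (ℓ.contDiff.comp_contDiffOn hsmooth) (hKD hx)]
  have h2 := hC x hx ℓ (List.ofFn v)
  have h3 : ((List.ofFn v).map norm).prod = ∏ i, ‖v i‖ := by
    rw [List.map_ofFn, List.prod_ofFn]; rfl
  rw [h3, List.length_ofFn] at h2
  rw [Real.norm_eq_abs]
  calc _ ≤ _ := h2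
    _ = _ := by ring

end Main
end DenjoyCarleman

theorem theorem4p10 {E F : Type*}
    [AddCommGroup E] [Module ℝ E] [TopologicalSpace E]
    [IsTopologicalAddGroup E] [ContinuousSMul ℝ E] [T2Space E]
    [NormedAddCommGroup F] [NormedSpace ℝ F] [CompleteSpace F]
    (hE : DenjoyCarleman.IsConvenient E)
    (τ : DenjoyCarleman.ClassType) (M : ℕ → ℝ) (hM : DenjoyCarleman.IsLogConvexWeight M)
    (U : Set E) (hU : DenjoyCarleman.IsCInftyOpen U)
    (f : E → F) (hf : DenjoyCarleman.IsClass τ M f U)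
    {G : Type*} [NormedAddCommGroup G] [NormedSpace ℝ G] [CompleteSpace G]
    (c : G → E) (hc : DenjoyCarleman.IsPlot τ M c)
    (hcU : Set.MapsTo c (Metric.ball 0 1) U) :
    DenjoyCarleman.IsClass τ M (f ∘ c) (Metric.ball 0 1) ∧
      DenjoyCarleman.IsNormedClass τ M (f ∘ c) (Metric.ball 0 1) := by
  have hcn := fun ℓ => hc.isNormedClass_apply hM.pos Metric.isOpen_ball ℓ
  have h := DenjoyCarleman.isNormedClass_comp_plot hE hM hU hf hcn hcU
  -- The convenient notion follows from the normed one by composing with `ℓ` and with the bounded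
  -- inclusion of `E_B`; smooth curves are simply mapped by `c` and then by `f`.
  refine ⟨⟨fun γ hγ hγD => ?_, fun ℓ B => ?_⟩, h⟩
  · exact hf.1 _ (hc.1 γ hγ hγD) fun t => hcU (hγD t)
  · exact (h.continuousLinearMap_comp hM.pos Metric.isOpen_ball ℓ).comp_continuousLinearMap hM.pos
      Metric.isOpen_ball B.inclL
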